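/- **Notation.** For $\operatorname{Im}\tau>0$ put $q^x=e^{2\pi i\tau x}$. Let $m\in\mathbb Z_{\ge 0}$, and let $z_1,z_2,t,v,z\in\mathbb C$. * Mock theta function: $\Phi^{[B;m]}(\tau,z_1,z_2,t)=\Phi_1^{[B;m]}(\tau,z_1,z_2,t)-\Phi_1^{[B;m]}(\tau,z_2,z_1,t)$, where $$\Phi_1^{[B;m]}(\tau,z_1,z_2,t)=e^{2\pi i(m+\frac12)t}\sum_{j\in\mathbb Z}(-1)^j\frac{e^{\pi i j(2m+1)(z_1+z_2)+\pi i z_1}\,q^{(m+\frac12)j^2+\frac j2}}{1-e^{2\pi i z_1}q^j}.$$ * Correction: let $E(x)=2\int_0^xe^{-\pi u^2}du$, and for $j\in\mathbb Z$ $$R^{[B]}_{j+\frac12,m+\frac12}(\tau,v)=\sum_{\substack{n\in\frac12+\mathbb Z\\ n\equiv j+\frac12\bmod 2m+1}}(-1)^{n-(j+\frac12)}\Big\{\operatorname{sgn}(n)-E\Big(\big(n+(2m+1)\tfrac{\operatorname{Im}v}{\operatorname{Im}\tau}\big)\sqrt{\tfrac{\operatorname{Im}\tau}{m+1/2}}\Big)\Big\}e^{-\frac{\pi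 i n^2\tau}{2m+1}-2\pi i nv},$$ $$\Theta^-_{s,d}(\tau,z)=\sum_{n\in\mathbb Z}(-1)^ne^{2\pi i d z(n+\frac s{2d})}q^{d(n+\frac s{2d})^2},$$ $$\Phi^{[B;m]}_{add}(\tau,z_1,z_2,t)=\tfrac12e^{2\pi i(m+\frac12)t}\sum_{j=0}^{2m}R^{[B]}_{j+\frac12,m+\frac12}\big(\tau,\tfrac{z_1-z_2}2\big)\big(\Theta^-_{j+\frac12,m+\frac12}+\Theta^-_{-(j+\frac12),m+\frac12}\big)(\tau,z_1+z_2),$$ and $\widetilde\Phi^{[B;m]}=\Phi^{[B;m]}+\Phi^{[B;m]}_{add}$. * For $M\in\mathbb Z_{\ge1}$, $\epsilon,\epsilon'\in\{0,\frac12\}$ and $a,b\in\epsilon'+\mathbb Z$ with $a-b\in2\mathbb Z$: $$\widetilde\Psi^{[B;M,m;\epsilon]}_{a,b;\epsilon'}(\tau,z_1,z_2,t)=q^{\frac{2m+1}{2M}ab}e^{\frac{2\pi i(2m+1)}{2M}(bz_1+az_2)}\,\widetilde\Phi^{[B;m]}\big(M\tau,z_1+a\tau+\epsilon,z_2+b\tau+\epsilon,\tfrac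 tM\big).$$ * $N=3$ (super)denominators: let $\eta$ be the Dedekind eta function and, for $a,b\in\{0,1\}$, $\vartheta_{ab}(\tau,z)=\sum_{n\in\mathbb Z}e^{\pi i(n+\frac a2)^2\tau+2\pi i(n+\frac a2)(z+\frac b2)}$. Put $$R^{(\frac12)}_{\frac12}(\tau,z)=\frac{\eta(\frac\tau2)\eta(2\tau)\vartheta_{11}(\tau,z)}{\vartheta_{00}(\tau,z)},\quad R^{(0)}_{\frac12}(\tau,z)=\frac{\eta(\tau)^3\vartheta_{11}(\tau,z)}{\eta(\frac\tau2)\vartheta_{01}(\tau,z)},\quad R^{(\frac12)}_{0}(\tau,z)=\frac{1}{\sqrt2}\,\frac{\eta(\tau)^3\vartheta_{11}(\tau,z)}{\eta(2\tau)\vartheta_{10}(\tau,z)}.$$ * Index sets: $\Omega^{[3;M]}_\epsilon=\{(j,k)\in(\epsilon+\mathbb Z)^2\mid 0\le k<M,\ 0<j+k<M,\ j-k\in2\mathbb Z\}$. The modified characters ($\epsilon=\frac12$) and supercharacters ($\epsilon=0$) of the $N=3$ superconformal modules obtained by quantum Hamiltonian reduction from the principal admissible $\widehat{osp}_{3|2}$-modules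 attached to $(M,m)$, in the Neveu–Schwarz sector ($\epsilon'=\frac12$) and in the Ramond sector ($\epsilon'=0$, $\epsilon=\frac12$), are the functions, for $\epsilon+\epsilon'\ne0$ and $(j,k)\in\Omega^{[3;M]}_{\epsilon'}$, $$\widetilde{ch}^{N=3[M,m;\epsilon]}_{j,k;\epsilon'}(\tau,z)=(-1)^{j-\epsilon'}\,\frac{\widetilde\Psi^{[B;M,m;\epsilon]}_{j,k;\epsilon'}(\tau,z,-z,0)}{R^{(\epsilon)}_{\epsilon'}(\tau,z)} .$$ **Theorem.** Let $m\in\mathbb Z_{\ge0}$ and $M\in\mathbb Z_{\ge2}$ with $\gcd(M,4m+2)=1$, let $\epsilon,\epsilon'\in\{0,\frac12\}$ with $\epsilon+\epsilon'\neq0$, let $c=-3\frac{2m+1}M$ and $(j,k)\in\Omega^{[3;M]}_{\epsilon'}$. Let $\operatorname{Im}\tau>0$ and $z\in\mathbb C$. 1. If $z\notin\mathbb Z+\mathbb Z\tau$ and $z\notin\epsilon'+\epsilon\tau+\mathbb Z+\mathbb Z\tau$, then $$\widetilde{ch}^{N=3[M,m;\epsilon]}_{j,k;\epsilon'}\Big(-\frac1\tau,\frac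 z\tau\Big)=e^{\frac{\pi i c z^2}{3\tau}}\sum_{(a,b)\in\Omega^{[3;M]}_\epsilon}S^{[\epsilon',\epsilon]}_{(j,k),(a,b)}\,\widetilde{ch}^{N=3[M,m;\epsilon']}_{a,b;\epsilon}(\tau,z),$$ where $$S^{[\frac12,\frac12]}_{(j,k),(a,b)}=\frac2M\,e^{\frac{\pi i(2m+1)}{2M}(a-b)(j-k)}\cos\Big(\frac{2m+1}{2M}(a+b)(j+k)\pi\Big),$$ $$S^{[\frac12,0]}_{(j,k),(a,b)}=-\frac{2i}M\,e^{\frac{\pi i(2m+1)}{2M}(a-b)(j-k)}\sin\Big(\frac{2m+1}{2M}(a+b)(j+k)\pi\Big),$$ $$S^{[0,\frac12]}_{(j,k),(a,b)}=\frac{2i}M\,e^{\frac{\pi i(2m+1)}{2M}(a-b)(j-k)}\sin\Big(\frac{2m+1}{2M}(a+b)(j+k)\pi\Big).$$ 2. If $z\notin\mathbb Z+\mathbb Z\tau$ and $z\notin\epsilon+\epsilon'(\tau+1)+\mathbb Z+\mathbb Z\tau$, then $$\widetilde{ch}^{N=3[M,m;\epsilon]}_{j,k;\epsilon'}(\tau+1,z)=e^{-\pi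 i(j+\frac1{12}-\frac{\epsilon'}4+4\epsilon\epsilon')}\,e^{\frac{2\pi i(2m+1)}{2M}jk}\,\widetilde{ch}^{N=3[M,m;|\epsilon-\epsilon'|]}_{j,k;\epsilon'}(\tau,z).$$ -/

import Mathlib

open scoped Real

noncomputable section

namespace SuperconformalN3

/-- `q ^ x = exp (2 π i τ x)`, where `q = exp (2 π i τ)`. -/
def qPow (τ x : ℂ) : ℂ := Complex.exp (2 * π * Complex.I * τ * x)

/-! ### The mock theta function attached to `osp(3|2)^` and its modification -/

/-- The function `Φ₁^{[B;m]}(τ, z₁, z₂, t)`, equal to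
`e^{2πi(m+1/2)t} ∑_j (-1)^j e^{πij(2m+1)(z₁+z₂)+πiz₁} q^{(m+1/2)j²+j/2} / (1 - e^{2πiz₁} q^j)`. -/
def Phi₁ (m : ℕ) (τ z₁ z₂ t : ℂ) : ℂ :=
  Complex.exp (2 * π * Complex.I * (m + 1 / 2) * t) *
    ∑' j : ℤ, (-1 : ℂ) ^ j *
      (Complex.exp (π * Complex.I * j * (2 * m + 1) * (z₁ + z₂) + π * Complex.I * z₁) *
        qPow τ ((m + 1 / 2) * (j : ℂ) ^ 2 + (j : ℂ) / 2)) /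
      (1 - Complex.exp (2 * π * Complex.I * z₁) * qPow τ j)

/-- The mock theta function `Φ^{[B;m]}`, the numerator of the normalized supercharacter of
the `osp(3|2)^`-module `L(m Λ₀)`. -/
def Phi (m : ℕ) (τ z₁ z₂ t : ℂ) : ℂ :=
  Phi₁ m τ z₁ z₂ t - Phi₁ m τ z₂ z₁ t

/-- `E(x) = 2 ∫_0^x e^{-πu²} du`. -/
def gaussE (x : ℝ) : ℝ := 2 * ∫ u in (0 : ℝ)..x, Real.exp (-π * u ^ 2)

/-- The Zwegers type real analytic function `R^{[B]}_{j+1/2, m+1/2}(τ, v)`.  The sum is over all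
`n ∈ 1/2 + ℤ` with `n ≡ j + 1/2 mod 2m+1`, written as `n = j + 1/2 + l (2m+1)` with `l ∈ ℤ`, so
that the sign `(-1)^{n - (j+1/2)}` is `(-1)^{l (2m+1)}`. -/
def zwegersR (m : ℕ) (j : ℤ) (τ v : ℂ) : ℂ :=
  ∑' l : ℤ,
    let n : ℝ := (j : ℝ) + 1 / 2 + l * (2 * m + 1)
    (-1 : ℂ) ^ (l * (2 * (m : ℤ) + 1)) *
      ((Real.sign n -
          gaussE ((n + (2 * m + 1) * (v.im / τ.im)) * √(τ.im / ((m : ℝ) + 1 / 2))) : ℝ) : ℂ) *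
      Complex.exp (-(π * Complex.I * (n : ℂ) ^ 2 * τ) / (2 * m + 1)
        - 2 * π * Complex.I * n * v)

/-- The alternate theta function of degree `d`:
`Θ⁻_{s,d}(τ, z) = ∑_n (-1)^n e^{2πidz(n+s/(2d))} q^{d(n+s/(2d))²}`. -/
def thetaAlt (s d : ℝ) (τ z : ℂ) : ℂ :=
  ∑' n : ℤ, (-1 : ℂ) ^ n *
    (Complex.exp (2 * π * Complex.I * d * z * (n + s / (2 * d))) *
      qPow τ (d * (n + s / (2 * d)) ^ 2))

/-- The non-holomorphic correction `Φ_add^{[B;m]}`. -/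
def PhiAdd (m : ℕ) (τ z₁ z₂ t : ℂ) : ℂ :=
  1 / 2 * Complex.exp (2 * π * Complex.I * (m + 1 / 2) * t) *
    ∑ j ∈ Finset.range (2 * m + 1),
      zwegersR m j τ ((z₁ - z₂) / 2) *
        (thetaAlt ((j : ℝ) + 1 / 2) ((m : ℝ) + 1 / 2) τ (z₁ + z₂) +
          thetaAlt (-((j : ℝ) + 1 / 2)) ((m : ℝ) + 1 / 2) τ (z₁ + z₂))

/-- The modification of `Φ^{[B;m]}`. -/
def PhiMod (m : ℕ) (τ z₁ z₂ t : ℂ) : ℂ :=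
  Phi m τ z₁ z₂ t + PhiAdd m τ z₁ z₂ t

/-- The modified function `Ψ̃^{[B;M,m;ε]}_{a,b;ε'}(τ, z₁, z₂, t)`, where `a, b ∈ ε' + ℤ`.  The
index `ε'` only records the class of `a, b` modulo `ℤ`, so it is not an argument here. -/
def PsiMod (M m : ℕ) (ε a b : ℝ) (τ z₁ z₂ t : ℂ) : ℂ :=
  qPow τ ((2 * m + 1) / (2 * M) * a * b) *
    Complex.exp (2 * π * Complex.I * (2 * m + 1) / (2 * M) * (b * z₁ + a * z₂)) *
    PhiMod m (M * τ) (z₁ + a * τ + ε) (z₂ + b * τ + ε) (t / M)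

/-! ### The `N = 3` denominators -/

/-- The four Jacobi theta functions with `a, b ∈ {0, 1}`,
`ϑ_{ab}(τ, z) = ∑_n exp (πi (n + a/2)² τ + 2πi (n + a/2) (z + b/2))`, written through Mathlib's
two-variable theta function. -/
def vartheta (a b : ℕ) (τ z : ℂ) : ℂ :=
  Complex.exp (π * Complex.I * (a : ℂ) ^ 2 * τ / 4 + π * Complex.I * a * (z + b / 2)) *
    jacobiTheta₂ (z + (a * τ + b) / 2) τ

/-- The Neveu-Schwarz `N = 3` normalized denominator. -/
def R3NSplus (τ z : ℂ) : ℂ :=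
  ModularForm.eta (τ / 2) * ModularForm.eta (2 * τ) * vartheta 1 1 τ z / vartheta 0 0 τ z

/-- The Neveu-Schwarz `N = 3` normalized superdenominator. -/
def R3NSminus (τ z : ℂ) : ℂ :=
  ModularForm.eta τ ^ 3 * vartheta 1 1 τ z / (ModularForm.eta (τ / 2) * vartheta 0 1 τ z)

/-- The Ramond `N = 3` normalized denominator. -/
def R3Ramond (τ z : ℂ) : ℂ :=
  ModularForm.eta τ ^ 3 * vartheta 1 1 τ z / (ModularForm.eta (2 * τ) * vartheta 1 0 τ z)

/-- `R3 ε ε'` for `ε, ε' ∈ {0, 1/2}`, `(ε, ε') ≠ (0, 0)`.  The superscript `ε` is `1/2` for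
denominators and `0` for superdenominators; the subscript `ε'` is `1/2` in the Neveu-Schwarz
sector and `0` in the Ramond sector (where the case `ε = 0` does not occur). -/
def R3 (ε ε' : ℝ) (τ z : ℂ) : ℂ :=
  if ε' = 1 / 2 then
    if ε = 1 / 2 then R3NSplus τ z else R3NSminus τ z
  else ((1 / √2 : ℝ) : ℂ) * R3Ramond τ z

/-! ### Modified characters, index sets, transformation matrices -/

/-- The modified (super)character of the `N = 3` module with index `(j, k)`,
`(-1)^{j-ε'} Ψ̃^{[B;M,m;ε]}_{j,k;ε'}(τ, z, -z, 0) / R3^{(ε)}_{ε'}(τ, z)`, where `j - ε' ∈ ℤ`. -/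
def chMod (M m : ℕ) (ε ε' j k : ℝ) (τ z : ℂ) : ℂ :=
  Complex.exp (π * Complex.I * (j - ε')) * PsiMod M m ε j k τ z (-z) 0 / R3 ε ε' τ z

/-- The index set `Ω^{[3;M]}_ε` as a set of pairs. -/
def omegaSet (M : ℕ) (ε : ℝ) : Set (ℝ × ℝ) :=
  {x | (∃ p : ℤ, x.1 = ε + p) ∧ (∃ r : ℤ, x.2 = ε + r) ∧ 0 ≤ x.2 ∧ x.2 < M ∧
    0 < x.1 + x.2 ∧ x.1 + x.2 < M ∧ ∃ n : ℤ, x.1 - x.2 = 2 * n}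

theorem omegaSet_finite (M : ℕ) (ε : ℝ) : (omegaSet M ε).Finite := by
  refine (((Set.finite_Icc ⌊-(M : ℝ) - ε⌋ ⌈(M : ℝ) - ε⌉).prod
    (Set.finite_Icc ⌊-(M : ℝ) - ε⌋ ⌈(M : ℝ) - ε⌉)).image
      (fun y : ℤ × ℤ => (ε + (y.1 : ℝ), ε + (y.2 : ℝ)))).subset ?_
  rintro ⟨x₁, x₂⟩ ⟨⟨p, hp⟩, ⟨r, hr⟩, h0, h1, h2, h3, -⟩
  simp only at hp hr h0 h1 h2 h3
  refine ⟨(p, r), ⟨⟨?_, ?_⟩, ⟨?_, ?_⟩⟩, by simp [hp, hr]⟩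
  · exact Int.cast_le.mp ((Int.floor_le (-(M : ℝ) - ε)).trans (by linarith))
  · exact Int.cast_le.mp (le_trans (b := (M : ℝ) - ε) (by linarith) (Int.le_ceil _))
  · exact Int.cast_le.mp ((Int.floor_le (-(M : ℝ) - ε)).trans (by linarith))
  · exact Int.cast_le.mp (le_trans (b := (M : ℝ) - ε) (by linarith) (Int.le_ceil _))

/-- The index set `Ω^{[3;M]}_ε` as a finite set. -/
def Omega (M : ℕ) (ε : ℝ) : Finset (ℝ × ℝ) := (omegaSet_finite M ε).toFinset

/-- The central charge `c = -3 (2m+1) / M`. -/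
def centralCharge (M m : ℕ) : ℝ := -3 * (2 * m + 1) / M

/-- The matrix `S^{[ε',ε]}_{(j,k),(a,b)}` with `x = (j,k)`, `y = (a,b)`. -/
def SMatrix (M m : ℕ) (ε' ε : ℝ) (x y : ℝ × ℝ) : ℂ :=
  let phase : ℂ := Complex.exp (π * Complex.I * (2 * m + 1) / (2 * M) *
    (y.1 - y.2) * (x.1 - x.2))
  let angle : ℝ := (2 * m + 1) / (2 * M) * (y.1 + y.2) * (x.1 + x.2) * π
  if ε' = ε then 2 / M * phase * Real.cos angle
  else if ε' = 1 / 2 then -(2 * Complex.I / M) * phase * Real.sin angle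
  else 2 * Complex.I / M * phase * Real.sin angle

/-- The points `z` off the lattice `ℤ + τℤ` of zeros of `ϑ₁₁(τ, ·)` and off its translate by
`ε + ε'τ`, where the theta function in the denominator of `R3^{(ε)}_{ε'}(τ, ·)` vanishes and
the functions `Ψ̃^{[B;M,m;ε]}_{j,k;ε'}(τ, z, -z, 0)` may have poles. -/
def IsRegular (ε ε' : ℝ) (τ z : ℂ) : Prop :=
  ∀ p r : ℤ, z ≠ p + r * τ ∧ z ≠ (p + ε) + (r + ε') * τ

end SuperconformalN3

end

open scoped Real

noncomputable section

namespace SuperconformalN3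

open Complex Filter Topology MeasureTheory ComplexConjugate

/-! ### Transformation of the theta functions and of the eta function -/

theorem jacobiTheta₂_add_one_right (z τ : ℂ) :
    jacobiTheta₂ z (τ + 1) = jacobiTheta₂ (z + 1 / 2) τ := by
  refine tsum_congr fun n => ?_
  rw [jacobiTheta₂_term, jacobiTheta₂_term, Complex.exp_eq_exp_iff_exists_int]
  obtain ⟨k, hk⟩ := Int.even_mul_pred_self n
  refine ⟨k, ?_⟩
  have hk' : (n : ℂ) * (n - 1) = k + k := by exact_mod_cast hk
  linear_combination (π * I : ℂ) * hk'

theorem vartheta_S (a b : ℕ) (ha : a ≤ 1) (τ z : ℂ) (hτ : τ ≠ 0) :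
    vartheta a b (-1 / τ) (z / τ) =
      exp (-(π * I * a * b / 2)) * (-I * τ) ^ (1 / 2 : ℂ) * exp (π * I * z ^ 2 / τ) *
        vartheta b a τ z := by
  have h1 : jacobiTheta₂ (z + (b * τ - a) / 2) τ = jacobiTheta₂ (z + (b * τ + a) / 2) τ := by
    interval_cases a
    · simp
    · rw [← jacobiTheta₂_add_left]
      congr 1
      push_cast
      ring
  have h2 := jacobiTheta₂_functional_equation (z + (b * τ - a) / 2) τ
  have h3 : (z + (b * τ - a) / 2) / τ = z / τ + (a * (-1 / τ) + b) / 2 := by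
    field_simp
    ring
  have h4 : (-I * τ) ^ (1 / 2 : ℂ) ≠ 0 := by
    rw [Complex.cpow_ne_zero_iff]
    left
    simpa using hτ
  rw [h3, h1] at h2
  unfold vartheta
  rw [h2]
  have h5 : exp (π * I * (a : ℂ) ^ 2 * (-1 / τ) / 4 + π * I * a * (z / τ + b / 2)) =
      exp (-(π * I * a * b / 2)) * exp (π * I * z ^ 2 / τ) *
        exp (π * I * (b : ℂ) ^ 2 * τ / 4 + π * I * b * (z + a / 2)) *
        exp (-π * I * (z + (b * τ - a) / 2) ^ 2 / τ) := by
    simp only [← Complex.exp_add]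
    congr 1
    field_simp
    ring
  rw [h5]
  field_simp

theorem vartheta_T_zero_zero (τ z : ℂ) : vartheta 0 0 (τ + 1) z = vartheta 0 1 τ z := by
  simp [vartheta, jacobiTheta₂_add_one_right]

theorem vartheta_T_zero_one (τ z : ℂ) : vartheta 0 1 (τ + 1) z = vartheta 0 0 τ z := by
  simp only [vartheta, jacobiTheta₂_add_one_right]
  rw [← jacobiTheta₂_add_left (z + _)]
  norm_num
  congr 1
  ring

theorem vartheta_T_one (b : ℕ) (τ z : ℂ) :
    vartheta 1 b (τ + 1) z = exp (π * I / 4) * vartheta 1 b τ z := by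
  simp only [vartheta, jacobiTheta₂_add_one_right]
  rw [← jacobiTheta₂_add_left (z + ((1 : ℕ) * τ + b) / 2), ← mul_assoc, ← Complex.exp_add]
  congr 2
  · push_cast
    ring
  · push_cast
    ring

theorem eta_add_one (τ : ℂ) :
    ModularForm.eta (τ + 1) = exp (π * I / 12) * ModularForm.eta τ := by
  have h : ∀ n : ℕ, ModularForm.eta_q n (τ + 1) = ModularForm.eta_q n τ := by
    intro n
    rw [ModularForm.eta_q_eq_pow, ModularForm.eta_q_eq_pow, mul_add, Complex.exp_add]
    simp
  simp only [ModularForm.eta, h, Function.Periodic.qParam]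
  rw [← mul_assoc, ← Complex.exp_add]
  congr 2
  push_cast
  ring

theorem eta_neg_one_div {τ : ℂ} (hτ : 0 < τ.im) :
    ModularForm.eta (-1 / τ) = (sqrt I)⁻¹ * sqrt τ * ModularForm.eta τ := by
  have := ModularForm.eta_comp_eq_csqrt_I_inv hτ
  simpa [mul_assoc] using this

theorem sqrt_sq' (x : ℂ) : sqrt x ^ 2 = x := by
  simp [sqrt]


theorem multipliable_one_sub_pow_odd {q : ℂ} (hq : ‖q‖ < 1) :
    Multipliable fun n : ℕ => 1 - q ^ (2 * n + 1) := by
  simp only [sub_eq_add_neg]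
  refine multipliable_one_add_of_summable ?_
  simp only [norm_neg, norm_pow]
  exact (summable_geometric_of_lt_one (norm_nonneg _) hq).comp_injective
    (i := fun n : ℕ => 2 * n + 1) fun a b h => by simpa using h

theorem tprod_one_sub_pow_eq_odd_mul {q : ℂ} (hq : ‖q‖ < 1) :
    ∏' n : ℕ, (1 - q ^ (n + 1)) =
      (∏' n : ℕ, (1 - q ^ (2 * n + 1))) * ∏' n : ℕ, (1 - (q ^ 2) ^ (n + 1)) := by
  have ho : Multipliable fun n : ℕ => 1 - q ^ (2 * n + 1) := multipliable_one_sub_pow_odd hq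
  have hq2 : ‖q ^ 2‖ < 1 := by
    rw [norm_pow]
    exact pow_lt_one₀ (norm_nonneg _) hq two_ne_zero
  have he : Multipliable fun n : ℕ => 1 - q ^ (2 * n + 1 + 1) := by
    refine (ModularForm.multipliable_one_sub_pow hq2).congr fun n => ?_
    rw [← pow_mul]
    ring_nf
  rw [← tprod_even_mul_odd (f := fun n : ℕ => 1 - q ^ (n + 1)) ho he]
  congr 1
  refine tprod_congr fun n => ?_
  rw [← pow_mul]
  ring_nf

theorem tprod_one_sub_pow_identity {r : ℂ} (hr : ‖r‖ < 1) :
    (∏' n : ℕ, (1 - (-r) ^ (n + 1))) * (∏' n : ℕ, (1 - r ^ (n + 1))) *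
      (∏' n : ℕ, (1 - (r ^ 4) ^ (n + 1))) = (∏' n : ℕ, (1 - (r ^ 2) ^ (n + 1))) ^ 3 := by
  have hr' : ‖-r‖ < 1 := by rwa [norm_neg]
  have hr2 : ‖r ^ 2‖ < 1 := by
    rw [norm_pow]
    exact pow_lt_one₀ (norm_nonneg _) hr two_ne_zero
  have h1 := tprod_one_sub_pow_eq_odd_mul hr
  have h2 := tprod_one_sub_pow_eq_odd_mul hr'
  have h3 := tprod_one_sub_pow_eq_odd_mul hr2
  have h4 : (∏' n : ℕ, (1 - (-r) ^ (2 * n + 1))) * (∏' n : ℕ, (1 - r ^ (2 * n + 1))) =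
      ∏' n : ℕ, (1 - (r ^ 2) ^ (2 * n + 1)) := by
    rw [← (multipliable_one_sub_pow_odd hr').tprod_mul (multipliable_one_sub_pow_odd hr)]
    refine tprod_congr fun n => ?_
    rw [Odd.neg_pow ⟨n, rfl⟩, ← pow_mul, mul_comm 2, pow_mul]
    ring
  rw [neg_sq] at h2
  rw [← pow_mul] at h3
  norm_num at h3
  rw [h1, h2]
  set A := ∏' n : ℕ, (1 - (r ^ 2) ^ (n + 1))
  linear_combination A ^ 2 * (∏' n : ℕ, (1 - (r ^ 4) ^ (n + 1))) * h4 - A ^ 2 * h3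

theorem eta_half_identity {τ : ℂ} (hτ : 0 < τ.im) :
    ModularForm.eta ((τ + 1) / 2) * ModularForm.eta (τ / 2) * ModularForm.eta (2 * τ) =
      exp (π * I / 24) * ModularForm.eta τ ^ 3 := by
  have hr : ‖exp (π * I * τ)‖ < 1 := by
    rw [Complex.norm_exp, Real.exp_lt_one_iff]
    simp
    positivity
  have key := tprod_one_sub_pow_identity hr
  have e1 : exp (2 * π * I * ((τ + 1) / 2)) = -exp (π * I * τ) := by
    rw [show 2 * π * I * ((τ + 1) / 2) = π * I * τ + π * I by ring, Complex.exp_add, exp_pi_mul_I]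
    ring
  have e2 : exp (2 * π * I * (τ / 2)) = exp (π * I * τ) := by
    congr 1
    ring
  have e3 : exp (2 * π * I * (2 * τ)) = exp (π * I * τ) ^ 4 := by
    rw [← Complex.exp_nat_mul]
    congr 1
    push_cast
    ring
  have e4 : exp (2 * π * I * τ) = exp (π * I * τ) ^ 2 := by
    rw [← Complex.exp_nat_mul]
    congr 1
    push_cast
    ring
  simp only [ModularForm.eta, ModularForm.eta_q_eq_pow, Function.Periodic.qParam, e1, e2, e3, e4]
  have e5 : exp (2 * π * I * ((τ + 1) / 2) / (24 : ℝ)) * exp (2 * π * I * (τ / 2) / (24 : ℝ)) *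
      exp (2 * π * I * (2 * τ) / (24 : ℝ)) =
      exp (π * I / 24) * exp (2 * π * I * τ / (24 : ℝ)) ^ 3 := by
    rw [← Complex.exp_nat_mul, ← Complex.exp_add, ← Complex.exp_add, ← Complex.exp_add]
    congr 1
    push_cast
    ring
  rw [mul_pow, ← mul_assoc (exp (π * I / 24)), ← e5, ← key]
  ring

/-! ### Transformation of the denominators -/

theorem sqrt_ofReal_mul {r : ℝ} (hr : 0 < r) {x : ℂ} (hx : x ≠ 0) :
    sqrt (r * x) = (√r : ℝ) * sqrt x := by
  have hr' : (r : ℂ) ≠ 0 := Complex.ofReal_ne_zero.mpr hr.ne'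
  rw [Complex.sqrt, Complex.sqrt, Complex.cpow_def_of_ne_zero (mul_ne_zero hr' hx),
    Complex.cpow_def_of_ne_zero hx, Complex.log_ofReal_mul hr hx, add_mul, Complex.exp_add,
    Real.sqrt_eq_rpow, Real.rpow_def_of_pos hr]
  norm_num

theorem eta_neg_one_div_ofReal_mul {τ : ℂ} (hτ : 0 < τ.im) {r : ℝ} (hr : 0 < r) :
    ModularForm.eta (-1 / (r * τ)) =
      (√r : ℝ) * ((sqrt I)⁻¹ * sqrt τ) * ModularForm.eta (r * τ) := by
  have hτ0 : τ ≠ 0 := by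
    rintro rfl
    simp at hτ
  rw [eta_neg_one_div (by simpa using mul_pos hr hτ), sqrt_ofReal_mul hr hτ0]
  ring

theorem sqrt_I_inv_mul_sqrt_sq (τ : ℂ) : ((sqrt I)⁻¹ * sqrt τ) ^ 2 = -I * τ := by
  rw [mul_pow, inv_pow, sqrt_sq', sqrt_sq', inv_I]

theorem exp_neg_pi_I_half : exp (-(π * I * (1 : ℕ) * (1 : ℕ) / 2)) = -I := by
  rw [show -(π * I * (1 : ℕ) * (1 : ℕ) / 2) = -(π / 2 * I) by push_cast; ring, Complex.exp_neg,
    exp_pi_div_two_mul_I, inv_I]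

theorem R3_S {ε ε' : ℝ} (hε : ε = 0 ∨ ε = 1 / 2) (hε' : ε' = 0 ∨ ε' = 1 / 2) (hne : ε + ε' ≠ 0)
    {τ : ℂ} (hτ : 0 < τ.im) (z : ℂ) : R3 ε ε' (-1 / τ) (z / τ) = -τ * R3 ε' ε τ z := by
  have hτ0 : τ ≠ 0 := by
    rintro rfl
    simp at hτ
  have hK : (-I * τ) ^ (1 / 2 : ℂ) ≠ 0 := by
    rw [Complex.cpow_ne_zero_iff]
    left
    simpa using hτ0
  have hE := Complex.exp_ne_zero (π * I * z ^ 2 / τ)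
  have hs := sqrt_I_inv_mul_sqrt_sq τ
  have hs0 : (sqrt I)⁻¹ * sqrt τ ≠ 0 := by
    intro h
    rw [h] at hs
    simp [hτ0] at hs
  have h1 := eta_neg_one_div hτ
  have h2 := eta_neg_one_div_ofReal_mul hτ (r := 2) (by norm_num)
  have h3 := eta_neg_one_div_ofReal_mul hτ (r := 1 / 2) (by norm_num)
  rw [show -1 / (((2 : ℝ) : ℂ) * τ) = -1 / τ / 2 by push_cast; field_simp] at h2
  rw [show -1 / (((1 / 2 : ℝ) : ℂ) * τ) = 2 * (-1 / τ) by push_cast; field_simp,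
    show ((1 / 2 : ℝ) : ℂ) * τ = τ / 2 by push_cast; ring] at h3
  push_cast at h2
  have h22 : ((√2 : ℝ) : ℂ) * ((√2 : ℝ) : ℂ) = 2 := by
    norm_cast
    exact Real.mul_self_sqrt (by norm_num)
  have h20 : ((√2 : ℝ) : ℂ) ≠ 0 := by
    norm_cast
    positivity
  have h2i : ((√(1 / 2) : ℝ) : ℂ) = 1 / (√2 : ℝ) := by
    rw [Real.sqrt_div (by norm_num)]
    simp
  rw [h2i] at h3
  have t11 := vartheta_S 1 1 le_rfl τ z hτ0
  have t00 := vartheta_S 0 0 zero_le_one τ z hτ0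
  have t01 := vartheta_S 0 1 zero_le_one τ z hτ0
  have t10 := vartheta_S 1 0 le_rfl τ z hτ0
  rw [exp_neg_pi_I_half] at t11
  simp only [Nat.cast_zero, mul_zero, zero_mul, zero_div, neg_zero, Complex.exp_zero, one_mul,
    Nat.cast_one] at t00 t01 t10
  set K := (-I * τ) ^ (1 / 2 : ℂ)
  set s := (sqrt I)⁻¹ * sqrt τ
  set Ez := exp (π * I * z ^ 2 / τ)
  have hKE : K * Ez ≠ 0 := mul_ne_zero hK hE
  rcases hε with rfl | rfl <;> rcases hε' with rfl | rfl
  · simp at hne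
  · simp only [R3, R3NSminus, R3Ramond]
    norm_num
    rw [h1, h2, t11, t01]
    simp only [div_eq_mul_inv, mul_inv]
    generalize (vartheta 1 0 τ z)⁻¹ = w, (ModularForm.eta (2 * τ))⁻¹ = v
    field_simp
    linear_combination (-I * ModularForm.eta τ ^ 3 * vartheta 1 1 τ z * w * v) * hs +
      ModularForm.eta τ ^ 3 * vartheta 1 1 τ z * w * v * τ * I_mul_I
  · simp only [R3, R3NSminus, R3Ramond]
    norm_num
    rw [h1, h3, t11, t10]
    simp only [div_eq_mul_inv, mul_inv]
    generalize (vartheta 0 1 τ z)⁻¹ = w, (ModularForm.eta (τ * 2⁻¹))⁻¹ = v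
    field_simp
    linear_combination (-I * ModularForm.eta τ ^ 3 * vartheta 1 1 τ z * w * v) * hs +
      ModularForm.eta τ ^ 3 * vartheta 1 1 τ z * w * v * τ * I_mul_I
  · simp only [R3, R3NSplus]
    norm_num
    rw [h2, h3, t11, t00]
    simp only [div_eq_mul_inv, mul_inv]
    generalize (vartheta 0 0 τ z)⁻¹ = w
    generalize ModularForm.eta (τ * 2⁻¹) = u
    field_simp
    linear_combination (-I * u * ModularForm.eta (2 * τ) * vartheta 1 1 τ z * w) * hs +
      u * ModularForm.eta (2 * τ) * vartheta 1 1 τ z * w * τ * I_mul_I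

theorem R3_T {ε ε' : ℝ} (hε : ε = 0 ∨ ε = 1 / 2) (hε' : ε' = 0 ∨ ε' = 1 / 2) (hne : ε + ε' ≠ 0)
    {τ : ℂ} (hτ : 0 < τ.im) (z : ℂ) :
    R3 ε ε' (τ + 1) z = exp (π * I * (1 / 12 + 3 * ε' / 4)) * R3 |ε - ε'| ε' τ z := by
  have h1 := eta_add_one τ
  have h2 : ModularForm.eta (2 * (τ + 1)) = exp (π * I / 12) ^ 2 * ModularForm.eta (2 * τ) := by
    rw [mul_add, mul_one, ← one_add_one_eq_two, ← add_assoc, eta_add_one, eta_add_one]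
    ring
  have h3 := eta_half_identity hτ
  have hη : ModularForm.eta (τ / 2) ≠ 0 := ModularForm.eta_ne_zero (by
    simpa [UpperHalfPlane.upperHalfPlaneSet] using hτ)
  have hη' : ModularForm.eta ((τ + 1) / 2) ≠ 0 := ModularForm.eta_ne_zero (by
    simpa [UpperHalfPlane.upperHalfPlaneSet] using hτ)
  set ζ := exp (π * I / 24) with hζ
  have e12 : exp (π * I / 12) = ζ ^ 2 := by
    rw [hζ, ← Complex.exp_nat_mul]
    congr 1
    push_cast
    ring
  have e4 : exp (π * I / 4) = ζ ^ 6 := by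
    rw [hζ, ← Complex.exp_nat_mul]
    congr 1
    push_cast
    ring
  have e0 : exp (π * I * (1 / 12 + 3 * ((0 : ℝ) : ℂ) / 4)) = ζ ^ 2 := by
    rw [hζ, ← Complex.exp_nat_mul]
    congr 1
    push_cast
    ring
  have eh : exp (π * I * (1 / 12 + 3 * ((1 / 2 : ℝ) : ℂ) / 4)) = ζ ^ 11 := by
    rw [hζ, ← Complex.exp_nat_mul]
    congr 1
    push_cast
    ring
  have hζ0 : ζ ≠ 0 := Complex.exp_ne_zero _
  have t11 := vartheta_T_one 1 τ z
  have t10 := vartheta_T_one 0 τ z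
  have t00 := vartheta_T_zero_zero τ z
  have t01 := vartheta_T_zero_one τ z
  rw [e12] at h1 h2
  rw [e4] at t11 t10
  rcases hε with rfl | rfl <;> rcases hε' with rfl | rfl
  · simp at hne
  · have : |(0 : ℝ) - 1 / 2| = 1 / 2 := by norm_num
    rw [this, eh]
    simp only [R3, R3NSminus, R3NSplus, if_true]
    norm_num
    rw [h1, t11, t01]
    simp only [div_eq_mul_inv, mul_inv]
    generalize (vartheta 0 0 τ z)⁻¹ = w
    rw [← div_eq_mul_inv, ← div_eq_mul_inv]
    field_simp
    rw [mul_comm 2 τ] at h3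
    linear_combination (-vartheta 1 1 τ z * w) * h3
  · have : |(1 / 2 : ℝ) - 0| = 1 / 2 := by norm_num
    rw [this, e0]
    simp only [R3, R3Ramond]
    norm_num
    rw [h1, h2, t11, t10]
    simp only [div_eq_mul_inv, mul_inv]
    generalize (vartheta 1 0 τ z)⁻¹ = w, (ModularForm.eta (2 * τ))⁻¹ = v
    field_simp
  · rw [eh]
    simp only [R3, R3NSminus, R3NSplus, if_true]
    norm_num
    rw [h2, t11, t00]
    simp only [div_eq_mul_inv, mul_inv]
    generalize (vartheta 0 1 τ z)⁻¹ = w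
    rw [← div_eq_mul_inv, ← div_eq_mul_inv]
    field_simp
    rw [mul_comm 2 τ] at h3
    linear_combination (vartheta 1 1 τ z * w) * h3

/-! ### The Gaussian error function -/

theorem continuous_exp_neg_pi_sq : Continuous fun u : ℝ => Real.exp (-π * u ^ 2) := by
  fun_prop

theorem hasDerivAt_gaussE (x : ℝ) : HasDerivAt gaussE (2 * Real.exp (-π * x ^ 2)) x := by
  have := (continuous_exp_neg_pi_sq.integral_hasStrictDerivAt 0 x).hasDerivAt
  exact this.const_mul 2

theorem gaussE_zero : gaussE 0 = 0 := by simp [gaussE]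

theorem gaussE_neg (x : ℝ) : gaussE (-x) = -gaussE x := by
  have h := intervalIntegral.integral_comp_neg (a := 0) (b := x)
    fun u : ℝ => Real.exp (-π * u ^ 2)
  simp only [neg_zero, neg_sq] at h
  rw [gaussE, gaussE, intervalIntegral.integral_symm, ← h]
  ring

theorem tendsto_gaussE_atTop : Tendsto gaussE atTop (𝓝 1) := by
  have h := (intervalIntegral_tendsto_integral_Ioi 0
    (integrable_exp_neg_mul_sq Real.pi_pos).integrableOn tendsto_id).const_mul 2
  rw [integral_gaussian_Ioi, div_self Real.pi_ne_zero] at h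
  convert! h using 2
  norm_num

theorem monotone_gaussE : Monotone gaussE :=
  monotone_of_deriv_nonneg (fun x => (hasDerivAt_gaussE x).differentiableAt) fun x => by
    rw [(hasDerivAt_gaussE x).deriv]
    positivity

theorem gaussE_le_one (x : ℝ) : gaussE x ≤ 1 :=
  monotone_gaussE.ge_of_tendsto tendsto_gaussE_atTop x

theorem neg_one_le_gaussE (x : ℝ) : -1 ≤ gaussE x := by
  have := gaussE_le_one (-x)
  rw [gaussE_neg] at this
  linarith

section Tail

variable {κ : ℝ}

theorem hasDerivAt_gaussE_comp (hκ : 0 < κ) (h g : ℝ) :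
    HasDerivAt (fun g => √κ / 2 * gaussE ((h + g) / √κ)) (Real.exp (-π * (h + g) ^ 2 / κ)) g := by
  have hs : √κ ≠ 0 := (Real.sqrt_pos.mpr hκ).ne'
  have h1 : HasDerivAt (fun g : ℝ => (h + g) / √κ) (1 / √κ) g :=
    ((hasDerivAt_id g).const_add h).div_const _
  convert! ((hasDerivAt_gaussE ((h + g) / √κ)).comp g h1).const_mul (√κ / 2) using 1
  rw [div_pow, Real.sq_sqrt hκ.le]
  field_simp

theorem tendsto_gaussE_comp (hκ : 0 < κ) (h : ℝ) :
    Tendsto (fun g => √κ / 2 * gaussE ((h + g) / √κ)) atTop (𝓝 (√κ / 2)) := by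
  have h1 : Tendsto (fun g : ℝ => (h + g) / √κ) atTop atTop :=
    (tendsto_atTop_add_const_left _ h tendsto_id).atTop_div_const (Real.sqrt_pos.mpr hκ)
  simpa using (tendsto_gaussE_atTop.comp h1).const_mul (√κ / 2)

theorem integrableOn_gaussian_tail (hκ : 0 < κ) (h γ : ℝ) :
    IntegrableOn (fun g : ℝ => Real.exp (-π * (h + g) ^ 2 / κ)) (Set.Ioi γ) :=
  integrableOn_Ioi_deriv_of_nonneg' (fun g _ => hasDerivAt_gaussE_comp hκ h g)
    (fun _ _ => (Real.exp_pos _).le) (tendsto_gaussE_comp hκ h)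

theorem integral_gaussian_tail (hκ : 0 < κ) (h γ : ℝ) :
    ∫ g in Set.Ioi γ, Real.exp (-π * (h + g) ^ 2 / κ) =
      √κ / 2 * (1 - gaussE ((h + γ) / √κ)) := by
  rw [integral_Ioi_of_hasDerivAt_of_tendsto' (fun g _ => hasDerivAt_gaussE_comp hκ h g)
    (integrableOn_gaussian_tail hκ h γ) (tendsto_gaussE_comp hκ h)]
  ring

end Tail

theorem one_sub_gaussE_le {x : ℝ} (hx : 0 ≤ x) : 1 - gaussE x ≤ Real.exp (-π * x ^ 2) := by
  have h1 := integral_gaussian_tail one_pos 0 x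
  have h2 := integral_gaussian_tail one_pos (-x) x
  have h3 : ∫ g in Set.Ioi x, Real.exp (-π * (0 + g) ^ 2 / 1) ≤
      ∫ g in Set.Ioi x, Real.exp (-π * x ^ 2) * Real.exp (-π * (-x + g) ^ 2 / 1) := by
    refine setIntegral_mono_on (integrableOn_gaussian_tail one_pos 0 x)
      ((integrableOn_gaussian_tail one_pos (-x) x).const_mul _) measurableSet_Ioi fun g hg => ?_
    rw [← Real.exp_add, Real.exp_le_exp]
    have h4 : 0 ≤ π * (x * (g - x)) :=
      mul_nonneg Real.pi_pos.le (mul_nonneg hx (sub_nonneg.mpr (le_of_lt hg)))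
    linarith
  rw [integral_const_mul, h1, h2] at h3
  simp only [neg_add_cancel, gaussE_zero, zero_add, Real.sqrt_one, div_one] at h3
  linarith

theorem abs_gaussE_sub_sign_le (x : ℝ) : |gaussE x - Real.sign x| ≤ Real.exp (-π * x ^ 2) := by
  rcases lt_trichotomy x 0 with hx | rfl | hx
  · have h1 := one_sub_gaussE_le (neg_nonneg.mpr hx.le)
    have h2 := neg_one_le_gaussE x
    rw [gaussE_neg, neg_sq] at h1
    rw [Real.sign_of_neg hx, abs_of_nonneg (by linarith)]
    linarith
  · simp [gaussE_zero]
  · have h1 := one_sub_gaussE_le hx.le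
    have h2 := gaussE_le_one x
    rw [Real.sign_of_pos hx, abs_of_nonpos (by linarith)]
    linarith

theorem abs_gaussE_sub_sign_le_gaussian {κ : ℝ} (hκ : 0 < κ) (h γ : ℝ) :
    |gaussE ((h + γ) / √κ) - Real.sign h| ≤
      2 * Real.exp (π * γ ^ 2 / κ) * Real.exp (-π * (h + γ) ^ 2 / κ) := by
  have hs : 0 < √κ := Real.sqrt_pos.mpr hκ
  by_cases hh : 0 < h * (h + γ)
  · have h1 : Real.sign h = Real.sign ((h + γ) / √κ) := by
      rcases pos_and_pos_or_neg_and_neg_of_mul_pos hh with ⟨h2, h3⟩ | ⟨h2, h3⟩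
      · rw [Real.sign_of_pos h2, Real.sign_of_pos (div_pos h3 hs)]
      · rw [Real.sign_of_neg h2, Real.sign_of_neg (div_neg_of_neg_of_pos h3 hs)]
    rw [h1]
    refine (abs_gaussE_sub_sign_le _).trans ?_
    rw [div_pow, Real.sq_sqrt hκ.le, ← mul_div_assoc]
    have : 1 ≤ Real.exp (π * γ ^ 2 / κ) := Real.one_le_exp (by positivity)
    have := Real.exp_pos (-π * (h + γ) ^ 2 / κ)
    nlinarith
  · have h2 : |gaussE ((h + γ) / √κ) - Real.sign h| ≤ 2 := by
      have h3 := gaussE_le_one ((h + γ) / √κ)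
      have h4 := neg_one_le_gaussE ((h + γ) / √κ)
      rcases Real.sign_apply_eq h with h5 | h5 | h5 <;> rw [h5, abs_le] <;>
        constructor <;> linarith
    refine h2.trans ?_
    rw [mul_assoc, ← Real.exp_add]
    have : 1 ≤ Real.exp (π * γ ^ 2 / κ + -π * (h + γ) ^ 2 / κ) := by
      refine Real.one_le_exp ?_
      rw [← add_div]
      refine div_nonneg ?_ hκ.le
      have h3 : (h + γ) ^ 2 ≤ γ ^ 2 := by nlinarith [sq_nonneg h]
      nlinarith [Real.pi_pos]
    linarith

/-! ### Summability of Gaussian families -/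

theorem summable_exp_neg_mul_int_sq {c : ℝ} (hc : 0 < c) :
    Summable fun n : ℤ => Real.exp (-c * (n : ℝ) ^ 2) := by
  have h : 0 < (I * (c / π : ℝ) : ℂ).im := by
    simpa using div_pos hc Real.pi_pos
  have := ((summable_jacobiTheta₂_term_iff 0 _).mpr h).norm
  refine this.congr fun n => ?_
  rw [norm_jacobiTheta₂_term]
  congr 1
  simp
  field_simp

theorem mul_le_sq_add {c : ℝ} (hc : 0 < c) (L x : ℝ) : L * x ≤ c / 2 * x ^ 2 + L ^ 2 / (2 * c) := by
  have h : c / 2 * x ^ 2 + L ^ 2 / (2 * c) - L * x = (c * x - L) ^ 2 / (2 * c) := by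
    field_simp
    ring
  have : 0 ≤ (c * x - L) ^ 2 / (2 * c) := by positivity
  linarith

theorem summable_of_norm_le_gaussian {f : ℤ → ℂ} {c K L : ℝ} (hc : 0 < c)
    (hf : ∀ n : ℤ, ‖f n‖ ≤ K * Real.exp (L * n - c * (n : ℝ) ^ 2)) : Summable f := by
  have h := (summable_exp_neg_mul_int_sq (half_pos hc)).mul_left (|K| * Real.exp (L ^ 2 / (2 * c)))
  refine Summable.of_norm_bounded h fun n => (hf n).trans ?_
  refine (mul_le_mul_of_nonneg_right (le_abs_self K) (Real.exp_pos _).le).trans ?_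
  rw [mul_assoc, ← Real.exp_add]
  refine mul_le_mul_of_nonneg_left (Real.exp_le_exp.mpr ?_) (abs_nonneg _)
  linarith [mul_le_sq_add hc L n]

theorem summable_exp_neg_mul_int_sq_add_sq {c : ℝ} (hc : 0 < c) :
    Summable fun x : ℤ × ℤ => Real.exp (-c * ((x.1 : ℝ) ^ 2 + (x.2 : ℝ) ^ 2)) := by
  refine (Summable.mul_of_nonneg (summable_exp_neg_mul_int_sq hc) (summable_exp_neg_mul_int_sq hc)
    (fun _ => (Real.exp_pos _).le) (fun _ => (Real.exp_pos _).le)).congr fun x => ?_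
  rw [← Real.exp_add]
  ring_nf

theorem summable_of_norm_le_gaussian_prod {f : ℤ × ℤ → ℂ} {c K L₁ L₂ : ℝ} (hc : 0 < c)
    (hf : ∀ x : ℤ × ℤ, ‖f x‖ ≤
      K * Real.exp (L₁ * x.1 + L₂ * x.2 - c * ((x.1 : ℝ) ^ 2 + (x.2 : ℝ) ^ 2))) :
    Summable f := by
  have h := (summable_exp_neg_mul_int_sq_add_sq (half_pos hc)).mul_left
    (|K| * Real.exp (L₁ ^ 2 / (2 * c) + L₂ ^ 2 / (2 * c)))
  refine Summable.of_norm_bounded h fun n => (hf n).trans ?_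
  refine (mul_le_mul_of_nonneg_right (le_abs_self K) (Real.exp_pos _).le).trans ?_
  rw [mul_assoc, ← Real.exp_add]
  refine mul_le_mul_of_nonneg_left (Real.exp_le_exp.mpr ?_) (abs_nonneg _)
  linarith [mul_le_sq_add hc L₁ n.1, mul_le_sq_add hc L₂ n.2]

/-! ### The expansion along a horizontal line -/

section Line

variable {κ : ℝ}

/-- The terms of the Gaussian regularization of `π / sin (π u)`. -/
def poleTerm (κ γ : ℝ) (b : ℤ) (u : ℂ) : ℂ :=
  (-1 : ℂ) ^ b * exp (-π * κ * (u + b) ^ 2 + 2 * π * I * γ * (u + b)) / (u + b)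

/-- The terms of the error function series. -/
def errorTerm (κ γ : ℝ) (r : ℤ) (u : ℂ) : ℂ :=
  ((gaussE (((r : ℝ) + 1 / 2 + γ) / √κ) - Real.sign ((r : ℝ) + 1 / 2) : ℝ) : ℂ) *
    exp (-2 * π * I * (r + 1 / 2) * u)

theorem norm_neg_one_zpow (n : ℤ) : ‖(-1 : ℂ) ^ n‖ = 1 := by simp

theorem norm_exp_pole (γ : ℝ) (b : ℤ) (u : ℂ) :
    ‖exp (-π * κ * (u + b) ^ 2 + 2 * π * I * γ * (u + b))‖ =
      Real.exp (-π * κ * (u.re + b) ^ 2 + π * κ * u.im ^ 2 - 2 * π * γ * u.im) := by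
  rw [Complex.norm_exp]
  congr 1
  simp [sq]
  ring

theorem norm_exp_error (r : ℤ) (u : ℂ) :
    ‖exp (-2 * π * I * (r + 1 / 2) * u)‖ = Real.exp (2 * π * (r + 1 / 2) * u.im) := by
  rw [Complex.norm_exp]
  congr 1
  simp

theorem norm_errorTerm_le (hκ : 0 < κ) (γ : ℝ) (r : ℤ) (u : ℂ) :
    ‖errorTerm κ γ r u‖ ≤ 2 * Real.exp (π * γ ^ 2 / κ) *
      Real.exp (-π * ((r : ℝ) + 1 / 2 + γ) ^ 2 / κ + 2 * π * (r + 1 / 2) * u.im) := by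
  rw [errorTerm, norm_mul, norm_exp_error, Complex.norm_real, Real.norm_eq_abs, Real.exp_add,
    ← mul_assoc]
  exact mul_le_mul_of_nonneg_right (abs_gaussE_sub_sign_le_gaussian hκ _ _) (Real.exp_pos _).le

theorem summable_errorTerm (hκ : 0 < κ) (γ : ℝ) (u : ℂ) : Summable fun r => errorTerm κ γ r u := by
  refine summable_of_norm_le_gaussian (c := π / κ)
    (K := 2 * Real.exp (π * γ ^ 2 / κ) * Real.exp (-π * (1 / 2 + γ) ^ 2 / κ + π * u.im))
    (L := -2 * π * (1 / 2 + γ) / κ + 2 * π * u.im) (by positivity) fun n => ?_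
  refine (norm_errorTerm_le hκ γ n u).trans (le_of_eq ?_)
  rw [mul_assoc (2 * Real.exp _), ← Real.exp_add]
  congr 2
  field_simp
  ring

theorem tsum_pole_theta (hκ : 0 < κ) (g : ℝ) (u : ℂ) :
    ∑' b : ℤ, (-1 : ℂ) ^ b * exp (-π * κ * (u + b) ^ 2 + 2 * π * I * g * (u + b)) =
      ∑' r : ℤ, (1 / √κ : ℝ) * exp (-2 * π * I * (r + 1 / 2) * u) *
        (Real.exp (-π * ((r : ℝ) + 1 / 2 + g) ^ 2 / κ) : ℝ) := by
  have hκ' : (κ : ℂ) ≠ 0 := Complex.ofReal_ne_zero.mpr hκ.ne'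
  have h := Complex.tsum_exp_neg_quadratic (a := κ) (by simpa using hκ)
    (-κ * u + I * g + I / 2)
  have h1 : ∀ b : ℤ, (-1 : ℂ) ^ b * exp (-π * κ * (u + b) ^ 2 + 2 * π * I * g * (u + b)) =
      exp (-π * κ * u ^ 2 + 2 * π * I * g * u) *
        exp (-π * κ * (b : ℂ) ^ 2 + 2 * π * (-κ * u + I * g + I / 2) * b) := by
    intro b
    rw [← exp_pi_mul_I, ← Complex.exp_int_mul, ← Complex.exp_add, ← Complex.exp_add]
    congr 1
    ring
  simp_rw [h1]
  rw [tsum_mul_left, h, ← mul_assoc, ← tsum_mul_left, ← (Equiv.neg ℤ).tsum_eq]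
  refine tsum_congr fun r => ?_
  have h2 : (1 : ℂ) / (κ : ℂ) ^ (1 / 2 : ℂ) = (1 / √κ : ℝ) := by
    rw [Real.sqrt_eq_rpow]
    push_cast [Complex.ofReal_cpow hκ.le]
    norm_num
  rw [h2, mul_comm (exp _), mul_assoc, ← Complex.exp_add, Complex.ofReal_exp,
    mul_assoc ((1 / √κ : ℝ) : ℂ), ← Complex.exp_add]
  congr 2
  have h3 : (((Equiv.neg ℤ) r : ℤ) : ℂ) + I * (-κ * u + I * g + I / 2) =
      -((r + g + 1 / 2) + I * κ * u) := by
    simp only [Equiv.neg_apply]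
    push_cast
    linear_combination (g + 1 / 2 : ℂ) * I_sq
  have hk := mul_inv_cancel₀ hκ'
  rw [h3]
  push_cast
  rw [div_eq_mul_inv, div_eq_mul_inv]
  linear_combination (-π * (κ : ℂ)⁻¹ * κ ^ 2 * u ^ 2) * I_sq +
    (π * κ * u ^ 2 - 2 * π * (r + g + 1 / 2) * I * u) * hk

theorem tsum_pole_eq_of_im_pos (hκ : 0 < κ) (γ : ℝ) {u : ℂ} (hu : 0 < u.im) :
    ∑' b : ℤ, poleTerm κ γ b u = π / sin (π * u) + π * I * ∑' r : ℤ, errorTerm κ γ r u := by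
  have hsq : 0 < √κ := Real.sqrt_pos.mpr hκ
  set F : ℤ → ℝ → ℂ := fun b g =>
    (-1 : ℂ) ^ b * exp (-π * κ * (u + b) ^ 2 + 2 * π * I * g * (u + b)) with hF
  set H : ℤ → ℝ → ℂ := fun r g => (1 / √κ : ℝ) * exp (-2 * π * I * (r + 1 / 2) * u) *
    (Real.exp (-π * ((r : ℝ) + 1 / 2 + g) ^ 2 / κ) : ℝ) with hH
  have hre : ∀ b : ℤ, (2 * π * I * (u + b)).re < 0 := by
    intro b
    simp
    positivity
  have hF1 : ∀ b, F b = fun g : ℝ =>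
      (-1 : ℂ) ^ b * exp (-π * κ * (u + b) ^ 2) * exp (2 * π * I * (u + b) * g) := by
    intro b
    ext g
    simp only [hF]
    rw [mul_assoc ((-1 : ℂ) ^ b), ← Complex.exp_add]
    ring_nf
  have hFint : ∀ b, IntegrableOn (F b) (Set.Ioi γ) := by
    intro b
    rw [hF1]
    exact (integrableOn_exp_mul_complex_Ioi (hre b) γ).const_mul _
  have hFval : ∀ b, ∫ g in Set.Ioi γ, F b g = -1 / (2 * π * I) * poleTerm κ γ b u := by
    intro b
    rw [hF1, integral_const_mul, integral_exp_mul_complex_Ioi (hre b), poleTerm, Complex.exp_add]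
    have h1 : u + b ≠ 0 := by
      intro h
      have := hre b
      simp [h] at this
    rw [show 2 * π * I * (u + b) * (γ : ℂ) = 2 * π * I * γ * (u + b) by ring]
    field_simp
  have hFn : ∀ b, ∫ g in Set.Ioi γ, ‖F b g‖ =
      Real.exp (-π * κ * (u.re + b) ^ 2 + π * κ * u.im ^ 2) *
        (Real.exp (-2 * π * u.im * γ) / (2 * π * u.im)) := by
    intro b
    have h1 : ∀ g, ‖F b g‖ = Real.exp (-π * κ * (u.re + b) ^ 2 + π * κ * u.im ^ 2) *
        Real.exp (-2 * π * u.im * g) := by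
      intro g
      rw [hF, norm_mul, norm_neg_one_zpow, one_mul, norm_exp_pole g, ← Real.exp_add]
      congr 1
      ring
    simp_rw [h1]
    have h2 : -2 * π * u.im < 0 := by
      have := mul_pos Real.pi_pos hu
      linarith
    rw [integral_const_mul, integral_exp_mul_Ioi h2]
    congr 1
    rw [neg_mul, neg_mul, neg_div_neg_eq]
  have hFsum : Summable fun b => ∫ g in Set.Ioi γ, ‖F b g‖ := by
    simp_rw [hFn]
    refine Summable.mul_right _ ?_
    have : Summable fun b : ℤ =>
        ((Real.exp (-π * κ * (u.re + b) ^ 2 + π * κ * u.im ^ 2) : ℝ) : ℂ) := by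
      refine summable_of_norm_le_gaussian (c := π * κ) (L := -2 * π * κ * u.re)
        (K := Real.exp (-π * κ * u.re ^ 2 + π * κ * u.im ^ 2)) (by positivity) fun n => ?_
      rw [Complex.norm_real, Real.norm_eq_abs, Real.abs_exp, ← Real.exp_add]
      refine le_of_eq (congrArg _ ?_)
      ring
    exact_mod_cast this
  have hHint : ∀ r, IntegrableOn (H r) (Set.Ioi γ) := by
    intro r
    exact ((integrableOn_gaussian_tail hκ _ γ).ofReal).const_mul _
  have hHval : ∀ r, ∫ g in Set.Ioi γ, H r g = -1 / 2 *
      (((gaussE (((r : ℝ) + 1 / 2 + γ) / √κ) - 1 : ℝ) : ℂ) *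
        exp (-2 * π * I * (r + 1 / 2) * u)) := by
    intro r
    have h1 : ((√κ : ℝ) : ℂ) ≠ 0 := Complex.ofReal_ne_zero.mpr hsq.ne'
    rw [hH, integral_const_mul, integral_complex_ofReal, integral_gaussian_tail hκ]
    push_cast
    field_simp
    ring
  have hsplit : ∀ r : ℤ, ((gaussE (((r : ℝ) + 1 / 2 + γ) / √κ) - 1 : ℝ) : ℂ) *
        exp (-2 * π * I * (r + 1 / 2) * u) = errorTerm κ γ r u +
        ((Real.sign ((r : ℝ) + 1 / 2) - 1 : ℝ) : ℂ) * exp (-2 * π * I * (r + 1 / 2) * u) := by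
    intro r
    rw [errorTerm]
    push_cast
    ring
  have hw : ‖exp (2 * π * I * u)‖ < 1 := by
    rw [Complex.norm_exp, Real.exp_lt_one_iff]
    simp
    positivity
  have hsign : HasSum (fun r : ℤ => ((Real.sign ((r : ℝ) + 1 / 2) - 1 : ℝ) : ℂ) *
      exp (-2 * π * I * (r + 1 / 2) * u))
      (0 + -2 * exp (π * I * u) * (1 - exp (2 * π * I * u))⁻¹) := by
    refine HasSum.of_nat_of_neg_add_one ?_ ?_
    · refine hasSum_zero.congr_fun fun n => ?_
      have h1 : (0 : ℝ) < ((n : ℤ) : ℝ) + 1 / 2 := by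
        push_cast
        positivity
      rw [Real.sign_of_pos h1]
      simp
    · refine ((hasSum_geometric_of_norm_lt_one hw).mul_left (-2 * exp (π * I * u))).congr_fun
        fun n => ?_
      have h1 : ((-((n : ℤ) + 1) : ℤ) : ℝ) + 1 / 2 < 0 := by
        push_cast
        have : (0 : ℝ) ≤ n := Nat.cast_nonneg n
        linarith
      rw [Real.sign_of_neg h1, ← Complex.exp_nat_mul, mul_assoc (-2 : ℂ) (exp _), ← Complex.exp_add]
      push_cast
      ring_nf
  have hEsum : Summable fun r : ℤ => ((gaussE (((r : ℝ) + 1 / 2 + γ) / √κ) - 1 : ℝ) : ℂ) *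
      exp (-2 * π * I * (r + 1 / 2) * u) := by
    simp_rw [hsplit]
    exact (summable_errorTerm hκ γ u).add hsign.summable
  have hHn : ∀ r, ∫ g in Set.Ioi γ, ‖H r g‖ = 1 / 2 *
      ‖((gaussE (((r : ℝ) + 1 / 2 + γ) / √κ) - 1 : ℝ) : ℂ) *
        exp (-2 * π * I * (r + 1 / 2) * u)‖ := by
    intro r
    have h1 : ∀ g, ‖H r g‖ = 1 / √κ * ‖exp (-2 * π * I * (r + 1 / 2) * u)‖ *
        Real.exp (-π * ((r : ℝ) + 1 / 2 + g) ^ 2 / κ) := by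
      intro g
      rw [hH, norm_mul, norm_mul, Complex.norm_real, Complex.norm_real, Real.norm_eq_abs,
        Real.norm_eq_abs, Real.abs_exp, abs_of_nonneg (by positivity)]
    simp_rw [h1]
    rw [integral_const_mul, integral_gaussian_tail hκ, norm_mul, Complex.norm_real,
      Real.norm_eq_abs, abs_of_nonpos (by linarith [gaussE_le_one (((r : ℝ) + 1 / 2 + γ) / √κ)])]
    field_simp
    ring
  have hHsum : Summable fun r => ∫ g in Set.Ioi γ, ‖H r g‖ := by
    simp_rw [hHn]
    exact hEsum.norm.mul_left _
  have hA := (hasSum_integral_of_summable_integral_norm hFint hFsum).tsum_eq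
  have hB := (hasSum_integral_of_summable_integral_norm hHint hHsum).tsum_eq
  have hAB : (fun g : ℝ => ∑' b, F b g) = fun g => ∑' r, H r g :=
    funext fun g => tsum_pole_theta hκ g u
  rw [hAB, ← hB] at hA
  simp_rw [hFval, hHval] at hA
  rw [tsum_mul_left, tsum_mul_left] at hA
  have hpi : (π : ℂ) ≠ 0 := Complex.ofReal_ne_zero.mpr Real.pi_ne_zero
  simp_rw [hsplit] at hA
  rw [(summable_errorTerm hκ γ u).tsum_add hsign.summable, hsign.tsum_eq] at hA
  have hsin : π / sin (π * u) =
      π * I * (0 + -2 * exp (π * I * u) * (1 - exp (2 * π * I * u))⁻¹) := by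
    have h1 : exp (2 * π * I * u) = exp (π * I * u) ^ 2 := by
      rw [← Complex.exp_nat_mul]
      congr 1
      push_cast
      ring
    have h2 : (1 : ℂ) - exp (π * I * u) ^ 2 ≠ 0 := by
      rw [← h1, sub_ne_zero]
      intro h
      rw [← h] at hw
      simp at hw
    have h3 : sin (π * u) = ((exp (π * I * u))⁻¹ - exp (π * I * u)) * I / 2 := by
      rw [Complex.sin, ← Complex.exp_neg]
      ring_nf
    have h4 := Complex.exp_ne_zero (π * I * u)
    rw [h3, h1]
    set w := exp (π * I * u)
    have h5 : w⁻¹ - w ≠ 0 := by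
      intro h
      apply h2
      have : w * (w⁻¹ - w) = 0 := by rw [h, mul_zero]
      rwa [mul_sub, mul_inv_cancel₀ h4, ← sq] at this
    field_simp
    rw [I_sq]
    ring
  rw [hsin]
  have h6 : ∀ x y : ℂ, -1 / (2 * π * I) * x = -1 / 2 * y → x = π * I * y := by
    intro x y h
    field_simp at h
    linear_combination -h
  rw [h6 _ _ hA]
  ring

theorem summable_exp_neg_mul_int_add_sq {c : ℝ} (hc : 0 < c) (d : ℝ) :
    Summable fun n : ℤ => Real.exp (-c * ((n : ℝ) + d) ^ 2) := by
  have h : Summable fun n : ℤ => ((Real.exp (-c * ((n : ℝ) + d) ^ 2) : ℝ) : ℂ) := by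
    refine summable_of_norm_le_gaussian (c := c) (L := -2 * c * d) (K := Real.exp (-c * d ^ 2))
      hc fun n => ?_
    rw [Complex.norm_real, Real.norm_eq_abs, Real.abs_exp, ← Real.exp_add]
    refine le_of_eq (congrArg _ ?_)
    ring
  exact_mod_cast h

theorem differentiableAt_tsum_poleTerm (hκ : 0 < κ) (γ : ℝ) {u : ℂ} (hu : u ∈ integerComplement) :
    DifferentiableAt ℂ (fun w => ∑' b : ℤ, poleTerm κ γ b w) u := by
  have hopen : IsOpen integerComplement := isOpen_compl_range_intCast
  obtain ⟨ρ, hρ, hball⟩ := Metric.isOpen_iff.mp hopen u hu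
  set δ := min (ρ / 2) 1 with hδ
  have hδ0 : 0 < δ := lt_min (half_pos hρ) one_pos
  have hsep : ∀ w ∈ Metric.ball u δ, ∀ b : ℤ, δ ≤ ‖w + b‖ := by
    intro w hw b
    by_contra! h
    have h1 : ((-b : ℤ) : ℂ) ∈ Metric.ball u ρ := by
      rw [Metric.mem_ball, Complex.dist_eq] at hw ⊢
      have h2 : ((-b : ℤ) : ℂ) - u = -(w + b) + (w - u) := by
        push_cast
        ring
      rw [h2]
      refine (norm_add_le _ _).trans_lt ?_
      rw [norm_neg]
      have := min_le_left (ρ / 2) 1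
      linarith
    exact hball h1 ⟨-b, rfl⟩
  set R := ‖u‖ + 1 with hR
  have hsum : Summable fun b : ℤ => Real.exp (-(π * κ / 2) * (b : ℝ) ^ 2) *
      (Real.exp (2 * π * κ * R ^ 2 + 2 * π * |γ| * R) / δ) :=
    (summable_exp_neg_mul_int_sq (by positivity)).mul_right _
  refine (differentiableOn_tsum_of_summable_norm hsum (fun b w hw => ?_) Metric.isOpen_ball
    fun b w hw => ?_).differentiableAt (Metric.ball_mem_nhds u hδ0)
  · have h1 : w + b ≠ 0 := norm_pos_iff.mp (hδ0.trans_le (hsep w hw b))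
    have h2 : DifferentiableAt ℂ (poleTerm κ γ b) w := by
      unfold poleTerm
      fun_prop (disch := exact h1)
    exact h2.differentiableWithinAt
  · rw [poleTerm, norm_div, norm_mul, norm_neg_one_zpow, one_mul, norm_exp_pole γ, ← mul_div_assoc,
      ← Real.exp_add]
    refine div_le_div₀ (Real.exp_pos _).le (Real.exp_le_exp.mpr ?_) hδ0 (hsep w hw b)
    have hwR : ‖w‖ ≤ R := by
      rw [Metric.mem_ball, Complex.dist_eq] at hw
      have h1 := norm_add_le u (w - u)
      rw [add_sub_cancel] at h1
      have := min_le_right (ρ / 2) 1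
      linarith
    have hx := (Complex.abs_re_le_norm w).trans hwR
    have hy := (Complex.abs_im_le_norm w).trans hwR
    have hx2 : w.re ^ 2 ≤ R ^ 2 := sq_le_sq' (abs_le.mp hx).1 (abs_le.mp hx).2
    have hy2 : w.im ^ 2 ≤ R ^ 2 := sq_le_sq' (abs_le.mp hy).1 (abs_le.mp hy).2
    have h3 : -(γ * w.im) ≤ |γ| * R :=
      (neg_le_abs _).trans ((abs_mul _ _).le.trans (mul_le_mul_of_nonneg_left hy (abs_nonneg _)))
    have h4 : (b : ℝ) ^ 2 / 2 - R ^ 2 ≤ (w.re + b) ^ 2 := by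
      nlinarith [sq_nonneg (2 * w.re + b)]
    have h5 := mul_le_mul_of_nonneg_left h4 (by positivity : 0 ≤ π * κ)
    have h6 := mul_le_mul_of_nonneg_left hy2 (by positivity : 0 ≤ π * κ)
    have h7 := mul_le_mul_of_nonneg_left h3 (by positivity : 0 ≤ 2 * π)
    linarith

theorem differentiableAt_tsum_errorTerm (hκ : 0 < κ) (γ : ℝ) (u : ℂ) :
    DifferentiableAt ℂ (fun w => ∑' r : ℤ, errorTerm κ γ r w) u := by
  set R := ‖u‖ + 1 with hR
  have hsum : Summable fun r : ℤ => Real.exp (-(π / (2 * κ)) * ((r : ℝ) + (1 / 2 + γ)) ^ 2) *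
      (2 * Real.exp (π * γ ^ 2 / κ) * Real.exp (2 * π * κ * R ^ 2 + 2 * π * (|γ| * R))) :=
    (summable_exp_neg_mul_int_add_sq (by positivity) _).mul_right _
  refine (differentiableOn_tsum_of_summable_norm hsum (fun b w hw => ?_) Metric.isOpen_ball
    fun r w hw => ?_).differentiableAt (Metric.ball_mem_nhds u one_pos)
  · have h2 : DifferentiableAt ℂ (errorTerm κ γ b) w := by
      unfold errorTerm
      fun_prop
    exact h2.differentiableWithinAt
  · refine (norm_errorTerm_le hκ γ r w).trans ?_
    rw [mul_left_comm (Real.exp _), ← Real.exp_add]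
    refine mul_le_mul_of_nonneg_left (Real.exp_le_exp.mpr ?_) (by positivity)
    have hwR : ‖w‖ ≤ R := by
      rw [Metric.mem_ball, Complex.dist_eq] at hw
      have h1 := norm_add_le u (w - u)
      rw [add_sub_cancel] at h1
      linarith
    have hy := (Complex.abs_im_le_norm w).trans hwR
    have hy2 : w.im ^ 2 ≤ R ^ 2 := sq_le_sq' (abs_le.mp hy).1 (abs_le.mp hy).2
    have h3 : -(γ * w.im) ≤ |γ| * R :=
      (neg_le_abs _).trans ((abs_mul _ _).le.trans (mul_le_mul_of_nonneg_left hy (abs_nonneg _)))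
    have h4 := mul_le_sq_add (div_pos Real.pi_pos hκ) (2 * π * w.im) ((r : ℝ) + 1 / 2 + γ)
    have h5 : (2 * π * w.im) ^ 2 / (2 * (π / κ)) = 2 * π * κ * w.im ^ 2 := by
      field_simp
    rw [h5] at h4
    have h6 := mul_le_mul_of_nonneg_left hy2 (by positivity : 0 ≤ 2 * π * κ)
    have h7 := mul_le_mul_of_nonneg_left h3 (by positivity : 0 ≤ 2 * π)
    have h8 : -π * ((r : ℝ) + 1 / 2 + γ) ^ 2 / κ = -(π / κ) * ((r : ℝ) + 1 / 2 + γ) ^ 2 := by ring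
    have h9 : -(π / (2 * κ)) * ((r : ℝ) + (1 / 2 + γ)) ^ 2 =
        -(π / κ) * ((r : ℝ) + 1 / 2 + γ) ^ 2 / 2 := by
      field_simp
      ring
    rw [h8, h9]
    linarith

theorem sin_pi_mul_ne_zero_of_mem {u : ℂ} (hu : u ∈ integerComplement) : sin (π * u) ≠ 0 := by
  rw [Complex.sin_ne_zero_iff]
  intro k hk
  have hpi : (π : ℂ) ≠ 0 := Complex.ofReal_ne_zero.mpr Real.pi_ne_zero
  refine hu ⟨k, ?_⟩
  rw [mul_comm] at hk
  exact (mul_right_cancel₀ hpi hk).symm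

theorem tsum_pole_eq (hκ : 0 < κ) (γ : ℝ) {u : ℂ} (hu : u ∈ integerComplement) :
    ∑' b : ℤ, poleTerm κ γ b u = π / sin (π * u) + π * I * ∑' r : ℤ, errorTerm κ γ r u := by
  have hopen : IsOpen integerComplement := isOpen_compl_range_intCast
  have hf : AnalyticOnNhd ℂ (fun w => ∑' b : ℤ, poleTerm κ γ b w) integerComplement :=
    DifferentiableOn.analyticOnNhd
      (fun w hw => (differentiableAt_tsum_poleTerm hκ γ hw).differentiableWithinAt) hopen
  have hg : AnalyticOnNhd ℂ (fun w => π / sin (π * w) + π * I * ∑' r : ℤ, errorTerm κ γ r w)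
      integerComplement := by
    refine DifferentiableOn.analyticOnNhd (fun w hw => ?_) hopen
    have h1 := sin_pi_mul_ne_zero_of_mem hw
    have h2 := differentiableAt_tsum_errorTerm hκ γ w
    have h3 : DifferentiableAt ℂ (fun w : ℂ => π / sin (π * w)) w := by
      fun_prop (disch := exact h1)
    exact (h3.add (h2.const_mul _)).differentiableWithinAt
  have hconn : IsPreconnected integerComplement :=
    ((Set.countable_range _).isConnected_compl_of_one_lt_rank
      (by rw [Complex.rank_real_complex]; norm_num)).isPreconnected
  have hI : I ∈ integerComplement := by
    rintro ⟨n, hn⟩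
    simpa using congrArg Complex.im hn
  refine hf.eqOn_of_preconnected_of_eventuallyEq hg hconn hI ?_ hu
  filter_upwards [(isOpen_lt continuous_const Complex.continuous_im).mem_nhds
    (show (0 : ℝ) < I.im by simp)] with w hw
  exact tsum_pole_eq_of_im_pos hκ γ hw

end Line

/-! ### The Gaussian lattice sum -/

/-- The general term, indexed by the lattice point `aτ + b`, of the Gaussian regularization of
the Appell sum `Phi₁`. -/
def latticeTerm (m : ℕ) (τ z₁ z₂ : ℂ) (x : ℤ × ℤ) : ℂ :=
  (-1 : ℂ) ^ (x.1 + x.2 + x.1 * x.2) *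
    exp (π * I * (2 * m + 1) * (x.1 * z₂ - (z₁ + x.1 * τ + x.2) *
      (z₂ - conj z₂ + conj (z₁ + x.1 * τ + x.2)) / (τ - conj τ))) / (z₁ + x.1 * τ + x.2)

/-- The index `κ = (2m+1) / (2 Im τ)`. -/
def gaussIndex (m : ℕ) (τ : ℂ) : ℝ := (2 * m + 1) / (2 * τ.im)

/-- The shift `γ = (2m+1) Im ((z₁ - z₂) / 2) / Im τ`. -/
def gaussShift (m : ℕ) (τ z₁ z₂ : ℂ) : ℝ := gaussIndex m τ * (z₁.im - z₂.im)

theorem gaussIndex_pos (m : ℕ) {τ : ℂ} (hτ : 0 < τ.im) : 0 < gaussIndex m τ := by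
  unfold gaussIndex
  positivity

theorem neg_one_zpow_eq_exp (n : ℤ) : (-1 : ℂ) ^ n = exp (π * I * n) := by
  rw [← exp_pi_mul_I, ← Complex.exp_int_mul, mul_comm]

theorem neg_one_zpow_neg (n : ℤ) : (-1 : ℂ) ^ (-n) = (-1) ^ n := by
  rw [zpow_neg, ← inv_zpow]
  norm_num

theorem neg_one_zpow_mul_odd (m : ℕ) (n : ℤ) : (-1 : ℂ) ^ (n * (2 * (m : ℤ) + 1)) = (-1) ^ n := by
  rw [mul_add, mul_one, zpow_add₀ (by norm_num), Even.neg_one_zpow ⟨n * m, by ring⟩, one_mul]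

theorem sub_conj_eq (z : ℂ) : z - conj z = 2 * z.im * I := by
  rw [Complex.sub_conj]
  push_cast
  ring

theorem conj_eq_sub (z : ℂ) : conj z = z - 2 * z.im * I := by
  rw [← sub_conj_eq]
  ring

theorem latticeTerm_eq_poleTerm (m : ℕ) {τ : ℂ} (hτ : 0 < τ.im) (z₁ z₂ : ℂ) (a b : ℤ) :
    latticeTerm m τ z₁ z₂ (a, b) =
      (-1 : ℂ) ^ a * exp (π * I * (2 * m + 1) * a * (z₁ + z₂ + a * τ)) *
        poleTerm (gaussIndex m τ) (gaussShift m τ z₁ z₂) b (z₁ + a * τ) := by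
  have hy : (τ.im : ℂ) ≠ 0 := Complex.ofReal_ne_zero.mpr hτ.ne'
  have h1 : (-1 : ℂ) ^ (a + b + a * b) =
      (-1 : ℂ) ^ a * ((-1 : ℂ) ^ b * exp (-(π * I * (2 * m + 1) * (a * b)))) := by
    rw [zpow_add₀ (by norm_num), zpow_add₀ (by norm_num), ← neg_one_zpow_neg (a * b),
      ← neg_one_zpow_mul_odd m (-(a * b)), neg_one_zpow_eq_exp (-(a * b) * _)]
    push_cast
    ring_nf
  have him : (z₁ + a * τ + b).im = z₁.im + a * τ.im := by simp
  simp only [latticeTerm, poleTerm, h1]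
  rw [← mul_div_assoc]
  congr 1
  have key : exp (-(π * I * (2 * m + 1) * (a * b))) *
      exp (π * I * (2 * m + 1) * (a * z₂ - (z₁ + a * τ + b) *
        (z₂ - conj z₂ + conj (z₁ + a * τ + b)) / (τ - conj τ))) =
      exp (π * I * (2 * m + 1) * a * (z₁ + z₂ + a * τ)) *
        exp (-π * gaussIndex m τ * (z₁ + a * τ + b) ^ 2 +
          2 * π * I * gaussShift m τ z₁ z₂ * (z₁ + a * τ + b)) := by
    rw [← Complex.exp_add, ← Complex.exp_add, sub_conj_eq z₂, sub_conj_eq τ,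
      conj_eq_sub (z₁ + a * τ + b), him]
    congr 1
    simp only [gaussIndex, gaussShift]
    push_cast
    field_simp
    ring
  linear_combination ((-1 : ℂ) ^ a * (-1 : ℂ) ^ b) * key

theorem exists_sq_add_sq_le (z : ℂ) {τ : ℂ} (hτ : 0 < τ.im) :
    ∃ K K' : ℝ, 0 < K ∧ ∀ a b : ℤ, (a : ℝ) ^ 2 + (b : ℝ) ^ 2 ≤ K * ‖z + a * τ + b‖ ^ 2 + K' := by
  set x := τ.re
  set y := τ.im
  set Q := 2 * (1 + 3 * x ^ 2) / y ^ 2 with hQ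
  have hQ0 : 0 ≤ Q := by positivity
  refine ⟨3 + Q, 3 * z.re ^ 2 + Q * z.im ^ 2, by positivity, fun a b => ?_⟩
  have h1 : ‖z + a * τ + b‖ ^ 2 = (z.re + a * x + b) ^ 2 + (z.im + a * y) ^ 2 := by
    rw [← Complex.normSq_eq_norm_sq, Complex.normSq_apply]
    simp [x, y]
    ring
  rw [h1]
  set X := z.re + a * x + b with hX
  set Y := z.im + a * y with hY
  have h2 : (b : ℝ) ^ 2 ≤ 3 * (X ^ 2 + z.re ^ 2 + a ^ 2 * x ^ 2) := by
    have : (b : ℝ) = X - z.re - a * x := by rw [hX]; ring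
    rw [this]
    nlinarith [sq_nonneg (X + z.re), sq_nonneg (X + a * x), sq_nonneg (z.re - a * x)]
  have h3 : (a : ℝ) ^ 2 * y ^ 2 ≤ 2 * (Y ^ 2 + z.im ^ 2) := by
    have : (a : ℝ) * y = Y - z.im := by rw [hY]; ring
    rw [← mul_pow, this]
    nlinarith [sq_nonneg (Y + z.im)]
  have h4 : (1 + 3 * x ^ 2) * (a : ℝ) ^ 2 ≤ Q * (Y ^ 2 + z.im ^ 2) := by
    rw [hQ, div_mul_eq_mul_div, le_div_iff₀ (by positivity)]
    nlinarith [mul_le_mul_of_nonneg_left h3 (by positivity : 0 ≤ 1 + 3 * x ^ 2)]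
  nlinarith [sq_nonneg X, sq_nonneg Y, mul_nonneg hQ0 (sq_nonneg X)]

theorem norm_latticeTerm (m : ℕ) {τ : ℂ} (hτ : 0 < τ.im) (z₁ z₂ : ℂ) (a b : ℤ) :
    ‖latticeTerm m τ z₁ z₂ (a, b)‖ =
      Real.exp (2 * π * gaussIndex m τ * z₁.im * z₂.im) *
        Real.exp (-π * gaussIndex m τ * ‖z₁ + a * τ + b‖ ^ 2) / ‖z₁ + a * τ + b‖ := by
  have h1 : ‖z₁ + a * τ + b‖ ^ 2 =
      (z₁.re + a * τ.re + b) ^ 2 + (z₁.im + a * τ.im) ^ 2 := by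
    rw [← Complex.normSq_eq_norm_sq, Complex.normSq_apply]
    simp
    ring
  have h2 : (2 * m + 1 : ℝ) = 2 * gaussIndex m τ * τ.im := by
    rw [gaussIndex]
    field_simp
  have h3 : ‖exp (π * I * (2 * m + 1) * a * (z₁ + z₂ + a * τ))‖ =
      Real.exp (-π * (2 * gaussIndex m τ * τ.im) * a * (z₁.im + z₂.im + a * τ.im)) := by
    rw [← h2, show (π * I * (2 * m + 1) * a * (z₁ + z₂ + a * τ) : ℂ) =
      ((π * (2 * m + 1) * a : ℝ) : ℂ) * (I * (z₁ + z₂ + a * τ)) by push_cast; ring,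
      Complex.norm_exp, Complex.re_ofReal_mul]
    congr 1
    simp
    ring
  rw [latticeTerm_eq_poleTerm m hτ, norm_mul, norm_mul, norm_neg_one_zpow, one_mul, h3, poleTerm,
    norm_div, norm_mul, norm_neg_one_zpow, one_mul, norm_exp_pole, ← mul_div_assoc,
    ← Real.exp_add, ← Real.exp_add, h1]
  congr 2
  simp [gaussShift]
  ring

theorem eventually_sq_add_sq_ge (C : ℝ) :
    ∀ᶠ x : ℤ × ℤ in cofinite, C < (x.1 : ℝ) ^ 2 + (x.2 : ℝ) ^ 2 := by
  have h := (summable_exp_neg_mul_int_sq_add_sq one_pos).tendsto_cofinite_zero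
  filter_upwards [h.eventually (gt_mem_nhds (Real.exp_pos (-C)))] with x hx
  have := Real.exp_lt_exp.mp hx
  linarith

theorem summable_latticeTerm (m : ℕ) {τ : ℂ} (hτ : 0 < τ.im) (z₁ z₂ : ℂ) :
    Summable (latticeTerm m τ z₁ z₂) := by
  obtain ⟨K, K', hK, h⟩ := exists_sq_add_sq_le z₁ hτ
  have hκ := gaussIndex_pos m hτ
  set κ := gaussIndex m τ with hκd
  have hs := (summable_exp_neg_mul_int_sq_add_sq (c := π * κ / K) (by positivity)).mul_left
    (Real.exp (2 * π * κ * z₁.im * z₂.im) * Real.exp (π * κ * K' / K))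
  refine Summable.of_norm_bounded_eventually hs ?_
  filter_upwards [eventually_sq_add_sq_ge (K + K')] with x hx
  have h1 := h x.1 x.2
  have h2 : 1 ≤ ‖z₁ + x.1 * τ + x.2‖ := by
    have : K * 1 < K * ‖z₁ + x.1 * τ + x.2‖ ^ 2 := by linarith
    have := lt_of_mul_lt_mul_left this hK.le
    nlinarith [norm_nonneg (z₁ + x.1 * τ + x.2)]
  rw [norm_latticeTerm m hτ]
  refine (div_le_self (by positivity) h2).trans ?_
  rw [mul_assoc (Real.exp (2 * π * κ * z₁.im * z₂.im)), ← Real.exp_add (π * κ * K' / K)]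
  refine mul_le_mul_of_nonneg_left (Real.exp_le_exp.mpr ?_) (Real.exp_pos _).le
  have h3 := mul_le_mul_of_nonneg_left h1 (by positivity : 0 ≤ π * κ / K)
  have h4 : π * κ / K * (K * ‖z₁ + x.1 * τ + x.2‖ ^ 2 + K') =
      π * κ * ‖z₁ + x.1 * τ + x.2‖ ^ 2 + π * κ * K' / K := by
    field_simp
  rw [h4] at h3
  linarith

/-! ### The error terms of the lattice sum -/

/-- The double series whose rows are the error terms of the lattice sum. -/
def doubleErrorTerm (m : ℕ) (τ z₁ z₂ : ℂ) (x : ℤ × ℤ) : ℂ :=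
  (-1 : ℂ) ^ x.1 * exp (π * I * (2 * m + 1) * x.1 * (z₁ + z₂ + x.1 * τ)) *
    errorTerm (gaussIndex m τ) (gaussShift m τ z₁ z₂) x.2 (z₁ + x.1 * τ)

theorem summable_doubleErrorTerm (m : ℕ) {τ : ℂ} (hτ : 0 < τ.im) (z₁ z₂ : ℂ) :
    Summable (doubleErrorTerm m τ z₁ z₂) := by
  have hκ := gaussIndex_pos m hτ
  set s : ℝ := 2 * m + 1 with hs
  have hs1 : 1 ≤ s := by
    have : (0 : ℝ) ≤ m := Nat.cast_nonneg m
    linarith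
  set κ := gaussIndex m τ with hκd
  set γ := gaussShift m τ z₁ z₂ with hγd
  set y := τ.im with hy
  have hκy : 1 / κ = 2 * y / s := by
    rw [hκd, gaussIndex]
    simp [s, y]
  refine summable_of_norm_le_gaussian_prod (c := π * y / (4 * s))
    (K := 2 * Real.exp (π * γ ^ 2 / κ) *
      Real.exp (-2 * π * y / s * (1 / 2 + γ) ^ 2 + π * z₁.im))
    (L₁ := -π * s * (z₁.im + z₂.im) + π * y)
    (L₂ := 2 * π * z₁.im - 4 * π * y / s * (1 / 2 + γ)) (by positivity) fun x => ?_
  have h3 : ‖exp (π * I * (2 * m + 1) * x.1 * (z₁ + z₂ + x.1 * τ))‖ =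
      Real.exp (-π * s * x.1 * (z₁.im + z₂.im + x.1 * y)) := by
    rw [show (π * I * (2 * m + 1) * x.1 * (z₁ + z₂ + x.1 * τ) : ℂ) =
      ((π * s * x.1 : ℝ) : ℂ) * (I * (z₁ + z₂ + x.1 * τ)) by rw [hs]; push_cast; ring,
      Complex.norm_exp, Complex.re_ofReal_mul]
    congr 1
    simp
    ring
  rw [doubleErrorTerm, norm_mul, norm_mul, norm_neg_one_zpow, one_mul, h3]
  refine (mul_le_mul_of_nonneg_left (norm_errorTerm_le hκ _ _ _) (Real.exp_pos _).le).trans ?_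
  rw [mul_left_comm, ← Real.exp_add, mul_assoc (2 * Real.exp _), ← Real.exp_add]
  refine mul_le_mul_of_nonneg_left (Real.exp_le_exp.mpr ?_) (by positivity)
  have h4 : (z₁ + x.1 * τ).im = z₁.im + x.1 * y := by simp [y]
  have h5 : -π * ((x.2 : ℝ) + 1 / 2 + γ) ^ 2 / κ =
      -π * ((x.2 : ℝ) + 1 / 2 + γ) ^ 2 * (2 * y / s) := by
    rw [← hκy]
    ring
  rw [h4, h5]
  set a : ℝ := (x.1 : ℝ)
  set r : ℝ := (x.2 : ℝ)
  have h6 : 0 ≤ (s * a - 4 / 3 * r) ^ 2 * (3 / 4) + (s ^ 2 - 1) * a ^ 2 / 4 + 5 / 12 * r ^ 2 := by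
    have : 0 ≤ s ^ 2 - 1 := by nlinarith
    positivity
  have h7 := mul_nonneg (by positivity : 0 ≤ π * y / s) h6
  have hs0 : s ≠ 0 := by linarith
  have h8 : π * y / s * ((s * a - 4 / 3 * r) ^ 2 * (3 / 4) + (s ^ 2 - 1) * a ^ 2 / 4 +
      5 / 12 * r ^ 2) = -2 * π * y / s * (1 / 2 + γ) ^ 2 + π * z₁.im +
        ((-π * s * (z₁.im + z₂.im) + π * y) * a +
          (2 * π * z₁.im - 4 * π * y / s * (1 / 2 + γ)) * r -
            π * y / (4 * s) * (a ^ 2 + r ^ 2)) -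
      (-π * s * a * (z₁.im + z₂.im + a * y) +
        (-π * (r + 1 / 2 + γ) ^ 2 * (2 * y / s) + 2 * π * (r + 1 / 2) * (z₁.im + a * y))) := by
    field_simp
    ring
  linarith

/-! ### The modified mock theta function as a lattice sum -/

/-- The general term of `zwegersR`, with `h = r + 1/2` and without the sign. -/
def zwegersTerm (m : ℕ) (τ v : ℂ) (r : ℤ) : ℂ :=
  ((Real.sign ((r : ℝ) + 1 / 2) - gaussE (((r : ℝ) + 1 / 2 + (2 * m + 1) * (v.im / τ.im)) *
      √(τ.im / ((m : ℝ) + 1 / 2))) : ℝ) : ℂ) *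
    exp (-(π * I * ((r : ℂ) + 1 / 2) ^ 2 * τ) / (2 * m + 1) - 2 * π * I * (r + 1 / 2) * v)

theorem zwegersR_eq (m : ℕ) (j : ℤ) (τ v : ℂ) :
    zwegersR m j τ v = ∑' l : ℤ, (-1 : ℂ) ^ l * zwegersTerm m τ v (l * (2 * m + 1) + j) := by
  refine tsum_congr fun l => ?_
  have h : (((l * (2 * m + 1) + j : ℤ) : ℝ) + 1 / 2) = (j : ℝ) + 1 / 2 + l * (2 * m + 1) := by
    push_cast
    ring
  have h' : (((l * (2 * m + 1) + j : ℤ) : ℂ) + 1 / 2) =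
      (((j : ℝ) + 1 / 2 + l * (2 * m + 1) : ℝ) : ℂ) := by
    push_cast
    ring
  simp only [zwegersTerm, neg_one_zpow_mul_odd, h, h', mul_assoc]

theorem zwegersTerm_neg (m : ℕ) (τ v : ℂ) (r : ℤ) :
    zwegersTerm m τ (-v) (-1 - r) = -zwegersTerm m τ v r := by
  have h : (((-1 - r : ℤ) : ℝ) + 1 / 2) = -((r : ℝ) + 1 / 2) := by
    push_cast
    ring
  have h' : (((-1 - r : ℤ) : ℂ) + 1 / 2) = -((r : ℂ) + 1 / 2) := by
    push_cast
    ring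
  simp only [zwegersTerm, h, h', Complex.neg_im]
  have h2 : (-((r : ℝ) + 1 / 2) + (2 * m + 1) * (-v.im / τ.im)) * √(τ.im / ((m : ℝ) + 1 / 2)) =
      -(((r : ℝ) + 1 / 2 + (2 * m + 1) * (v.im / τ.im)) * √(τ.im / ((m : ℝ) + 1 / 2))) := by
    ring
  have h3 : -(π * I * (-((r : ℂ) + 1 / 2)) ^ 2 * τ) / (2 * m + 1) -
      2 * π * I * -((r : ℂ) + 1 / 2) * -v =
      -(π * I * ((r : ℂ) + 1 / 2) ^ 2 * τ) / (2 * m + 1) - 2 * π * I * ((r : ℂ) + 1 / 2) * v := by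
    ring
  rw [h2, gaussE_neg, Real.sign_neg, h3]
  push_cast
  ring

theorem thetaAlt_shift (m : ℕ) (σ : ℝ) (l : ℤ) (τ w : ℂ) :
    thetaAlt (σ + l * (2 * m + 1)) ((m : ℝ) + 1 / 2) τ w =
      (-1) ^ l * thetaAlt σ ((m : ℝ) + 1 / 2) τ w := by
  unfold thetaAlt
  rw [← tsum_mul_left, ← (Equiv.addRight (-l)).tsum_eq]
  refine tsum_congr fun n => ?_
  have hm : (2 * (((m : ℝ) + 1 / 2 : ℝ) : ℂ)) ≠ 0 := by
    have : (0 : ℝ) < 2 * ((m : ℝ) + 1 / 2) := by positivity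
    exact_mod_cast this.ne'
  have h1 : (((Equiv.addRight (-l)) n : ℤ) : ℂ) +
      ((σ + l * (2 * m + 1) : ℝ) : ℂ) / (2 * (((m : ℝ) + 1 / 2 : ℝ) : ℂ)) =
      n + (σ : ℂ) / (2 * (((m : ℝ) + 1 / 2 : ℝ) : ℂ)) := by
    have hD : ((σ + l * (2 * m + 1) : ℝ) : ℂ) = σ + l * (2 * (((m : ℝ) + 1 / 2 : ℝ) : ℂ)) := by
      push_cast
      ring
    rw [hD, Equiv.coe_addRight]
    generalize 2 * (((m : ℝ) + 1 / 2 : ℝ) : ℂ) = D at hm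
    field_simp
    push_cast
    ring
  rw [h1, Equiv.coe_addRight, zpow_add₀ (by norm_num), neg_one_zpow_neg]
  ring

theorem tsum_int_eq_sum_tsum {f : ℤ → ℂ} (hf : Summable f) (m : ℕ) :
    ∑' r, f r = ∑ j ∈ Finset.range (2 * m + 1), ∑' l : ℤ, f (l * (2 * m + 1) + j) := by
  have h1 : Summable fun x : Fin (2 * m + 1) × ℤ => f (x.2 * (2 * m + 1) + (x.1 : ℕ)) := by
    have : Summable (f ∘ ((Int.divModEquiv (2 * m + 1)).trans (Equiv.prodComm _ _)).symm) :=
      (Equiv.summable_iff _).mpr hf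
    exact this.congr fun x => by simp [Int.divModEquiv]
  rw [← ((Int.divModEquiv (2 * m + 1)).trans (Equiv.prodComm _ _)).symm.tsum_eq f,
    Finset.sum_range fun j => ∑' l : ℤ, f (l * (2 * m + 1) + j),
    ← tsum_fintype (L := .unconditional (Fin (2 * m + 1)))]
  rw [← h1.tsum_prod (f := fun x : Fin (2 * m + 1) × ℤ => f (x.2 * (2 * m + 1) + (x.1 : ℕ)))]
  exact tsum_congr fun x => by simp [Int.divModEquiv]

theorem tsum_zwegersTerm_mul_thetaAlt (m : ℕ) {τ : ℂ} (v w : ℂ) {δ : ℝ} (hδ : δ = 1 ∨ δ = -1)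
    (hs : Summable fun r : ℤ => zwegersTerm m τ v r *
      thetaAlt (δ * ((r : ℝ) + 1 / 2)) ((m : ℝ) + 1 / 2) τ w) :
    ∑' r : ℤ, zwegersTerm m τ v r * thetaAlt (δ * ((r : ℝ) + 1 / 2)) ((m : ℝ) + 1 / 2) τ w =
      ∑ j ∈ Finset.range (2 * m + 1), zwegersR m j τ v *
        thetaAlt (δ * ((j : ℝ) + 1 / 2)) ((m : ℝ) + 1 / 2) τ w := by
  rw [tsum_int_eq_sum_tsum hs m]
  refine Finset.sum_congr rfl fun j _ => ?_
  rw [zwegersR_eq, ← tsum_mul_right]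
  refine tsum_congr fun l => ?_
  have h1 : thetaAlt (δ * (((l * (2 * m + 1) + j : ℤ) : ℝ) + 1 / 2)) ((m : ℝ) + 1 / 2) τ w =
      (-1) ^ l * thetaAlt (δ * ((j : ℝ) + 1 / 2)) ((m : ℝ) + 1 / 2) τ w := by
    rcases hδ with rfl | rfl
    · rw [← thetaAlt_shift]
      congr 1
      push_cast
      ring
    · rw [← neg_one_zpow_neg, ← thetaAlt_shift]
      congr 1
      push_cast
      ring
  rw [h1]
  ring

theorem doubleErrorTerm_eq (m : ℕ) {τ : ℂ} (hτ : 0 < τ.im) (z₁ z₂ : ℂ) (a r : ℤ) :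
    doubleErrorTerm m τ z₁ z₂ (a, r) = -zwegersTerm m τ ((z₁ - z₂) / 2) r *
      ((-1 : ℂ) ^ a * (exp (2 * π * I * ((m : ℝ) + 1 / 2 : ℝ) * (z₁ + z₂) *
        (a + ((-1 * ((r : ℝ) + 1 / 2) : ℝ) : ℂ) / (2 * ((m : ℝ) + 1 / 2 : ℝ)))) *
          qPow τ (((m : ℝ) + 1 / 2 : ℝ) *
            (a + ((-1 * ((r : ℝ) + 1 / 2) : ℝ) : ℂ) / (2 * ((m : ℝ) + 1 / 2 : ℝ))) ^ 2))) := by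
  have hκ := gaussIndex_pos m hτ
  have hy : τ.im ≠ 0 := hτ.ne'
  have hm : ((m : ℝ) + 1 / 2) ≠ 0 := by positivity
  have hm' : (2 * (m : ℂ) + 1) ≠ 0 := by
    have : (2 * (m : ℝ) + 1) ≠ 0 := by positivity
    exact_mod_cast this
  have h1 : ((r : ℝ) + 1 / 2 + gaussShift m τ z₁ z₂) / √(gaussIndex m τ) =
      ((r : ℝ) + 1 / 2 + (2 * m + 1) * (((z₁ - z₂) / 2).im / τ.im)) *
        √(τ.im / ((m : ℝ) + 1 / 2)) := by
    have h2 : τ.im / ((m : ℝ) + 1 / 2) = (gaussIndex m τ)⁻¹ := by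
      rw [gaussIndex]
      field_simp
    have h3 : ((z₁ - z₂) / 2).im = (z₁.im - z₂.im) / 2 := by simp
    rw [h2, Real.sqrt_inv, ← div_eq_mul_inv, h3, gaussShift, gaussIndex]
    congr 2
    field_simp
  have h2 : exp (π * I * (2 * m + 1) * a * (z₁ + z₂ + a * τ)) *
      exp (-2 * π * I * (r + 1 / 2) * (z₁ + a * τ)) =
      exp (-(π * I * ((r : ℂ) + 1 / 2) ^ 2 * τ) / (2 * m + 1) -
        2 * π * I * (r + 1 / 2) * ((z₁ - z₂) / 2)) *
      (exp (2 * π * I * ((m : ℝ) + 1 / 2 : ℝ) * (z₁ + z₂) *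
        (a + ((-1 * ((r : ℝ) + 1 / 2) : ℝ) : ℂ) / (2 * ((m : ℝ) + 1 / 2 : ℝ)))) *
          qPow τ (((m : ℝ) + 1 / 2 : ℝ) *
            (a + ((-1 * ((r : ℝ) + 1 / 2) : ℝ) : ℂ) / (2 * ((m : ℝ) + 1 / 2 : ℝ))) ^ 2)) := by
    rw [qPow, ← Complex.exp_add, ← Complex.exp_add, ← Complex.exp_add]
    congr 1
    have h4 : (((m : ℝ) + 1 / 2 : ℝ) : ℂ) = (2 * m + 1) / 2 := by
      push_cast
      ring
    have h5 : ((-1 * ((r : ℝ) + 1 / 2) : ℝ) : ℂ) = -(r + 1 / 2) := by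
      push_cast
      ring
    rw [h4, h5]
    generalize (2 * (m : ℂ) + 1) = s at hm'
    field_simp
    ring
  have h3 : ((gaussE (((r : ℝ) + 1 / 2 + gaussShift m τ z₁ z₂) / √(gaussIndex m τ)) -
      Real.sign ((r : ℝ) + 1 / 2) : ℝ) : ℂ) = -((Real.sign ((r : ℝ) + 1 / 2) -
        gaussE (((r : ℝ) + 1 / 2 + (2 * m + 1) * (((z₁ - z₂) / 2).im / τ.im)) *
          √(τ.im / ((m : ℝ) + 1 / 2))) : ℝ) : ℂ) := by
    rw [h1]
    push_cast
    ring
  simp only [doubleErrorTerm, errorTerm, zwegersTerm]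
  rw [h3]
  generalize ((Real.sign ((r : ℝ) + 1 / 2) -
        gaussE (((r : ℝ) + 1 / 2 + (2 * m + 1) * (((z₁ - z₂) / 2).im / τ.im)) *
          √(τ.im / ((m : ℝ) + 1 / 2))) : ℝ) : ℂ) = S
  linear_combination (-(-1 : ℂ) ^ a * S) * h2

theorem hasSum_zwegersTerm (m : ℕ) {τ : ℂ} (hτ : 0 < τ.im) (z₁ z₂ : ℂ) :
    HasSum (fun r : ℤ => zwegersTerm m τ ((z₁ - z₂) / 2) r *
      thetaAlt (-1 * ((r : ℝ) + 1 / 2)) ((m : ℝ) + 1 / 2) τ (z₁ + z₂))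
      (-∑' a : ℤ, ∑' r : ℤ, doubleErrorTerm m τ z₁ z₂ (a, r)) := by
  have hs := summable_doubleErrorTerm m hτ z₁ z₂
  have h1 : ∀ r : ℤ, ∑' a : ℤ, doubleErrorTerm m τ z₁ z₂ (a, r) =
      -(zwegersTerm m τ ((z₁ - z₂) / 2) r *
        thetaAlt (-1 * ((r : ℝ) + 1 / 2)) ((m : ℝ) + 1 / 2) τ (z₁ + z₂)) := by
    intro r
    simp_rw [doubleErrorTerm_eq m hτ]
    rw [tsum_mul_left, neg_mul, thetaAlt]
  have h2 := hs.prod_symm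
  have h3 := h2.prod
  have h4 := h2.tsum_prod
  simp only [Prod.swap_prod_mk] at h3 h4
  simp_rw [h1] at h3 h4
  have h5 : ∑' x : ℤ × ℤ, doubleErrorTerm m τ z₁ z₂ x.swap =
      ∑' a : ℤ, ∑' r : ℤ, doubleErrorTerm m τ z₁ z₂ (a, r) := by
    rw [← hs.tsum_prod, ← (Equiv.prodComm ℤ ℤ).tsum_eq (doubleErrorTerm m τ z₁ z₂)]
    rfl
  rw [h5] at h4
  have h6 := h3.neg.hasSum
  rw [tsum_neg, ← h4] at h6
  simpa using h6

theorem Phi₁_term_eq (m : ℕ) (τ z₁ z₂ : ℂ) (j : ℤ) (h : z₁ + j * τ ∈ integerComplement) :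
    (-1 : ℂ) ^ j * (exp (π * I * j * (2 * m + 1) * (z₁ + z₂) + π * I * z₁) *
        qPow τ ((m + 1 / 2) * (j : ℂ) ^ 2 + (j : ℂ) / 2)) / (1 - exp (2 * π * I * z₁) * qPow τ j) =
      I / 2 * ((-1 : ℂ) ^ j * exp (π * I * (2 * m + 1) * j * (z₁ + z₂ + j * τ)) *
        (1 / sin (π * (z₁ + j * τ)))) := by
  have hs := sin_pi_mul_ne_zero_of_mem h
  set W := exp (π * I * (z₁ + j * τ)) with hW
  have hW0 : W ≠ 0 := Complex.exp_ne_zero _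
  have h1 : exp (2 * π * I * z₁) * qPow τ j = W ^ 2 := by
    rw [qPow, hW, ← Complex.exp_nat_mul, ← Complex.exp_add]
    congr 1
    push_cast
    ring
  have h2 : exp (π * I * j * (2 * m + 1) * (z₁ + z₂) + π * I * z₁) *
      qPow τ ((m + 1 / 2) * (j : ℂ) ^ 2 + (j : ℂ) / 2) =
      exp (π * I * (2 * m + 1) * j * (z₁ + z₂ + j * τ)) * W := by
    rw [qPow, hW, ← Complex.exp_add, ← Complex.exp_add]
    congr 1
    ring
  have h3 : sin (π * (z₁ + j * τ)) = (W⁻¹ - W) * I / 2 := by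
    rw [Complex.sin, hW, ← Complex.exp_neg]
    ring_nf
  have h4 : W⁻¹ - W ≠ 0 := by
    intro h5
    rw [h3, h5] at hs
    simp at hs
  have h5 : 1 - W ^ 2 ≠ 0 := by
    intro h6
    apply h4
    field_simp
    rw [h6, mul_zero]
  rw [h1, h2, h3]
  have h6 : W⁻¹ - W = (1 - W ^ 2) / W := by
    field_simp
  rw [h6]
  field_simp

theorem tsum_latticeTerm (m : ℕ) {τ : ℂ} (hτ : 0 < τ.im) (z₁ z₂ : ℂ)
    (h : ∀ a : ℤ, z₁ + a * τ ∈ integerComplement) :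
    I / (2 * π) * ∑' x, latticeTerm m τ z₁ z₂ x = Phi₁ m τ z₁ z₂ 0 +
      1 / 2 * ∑' r : ℤ, zwegersTerm m τ ((z₁ - z₂) / 2) r *
        thetaAlt (-1 * ((r : ℝ) + 1 / 2)) ((m : ℝ) + 1 / 2) τ (z₁ + z₂) := by
  have hs := summable_latticeTerm m hτ z₁ z₂
  have hκ := gaussIndex_pos m hτ
  have hpi : (π : ℂ) ≠ 0 := Complex.ofReal_ne_zero.mpr Real.pi_ne_zero
  set P : ℤ → ℂ := fun a => (-1 : ℂ) ^ a * exp (π * I * (2 * m + 1) * a * (z₁ + z₂ + a * τ)) *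
    (1 / sin (π * (z₁ + a * τ))) with hP
  have h1 : ∀ a : ℤ, ∑' b : ℤ, latticeTerm m τ z₁ z₂ (a, b) =
      π * P a + π * I * ∑' r : ℤ, doubleErrorTerm m τ z₁ z₂ (a, r) := by
    intro a
    simp_rw [latticeTerm_eq_poleTerm m hτ, doubleErrorTerm]
    rw [tsum_mul_left, tsum_mul_left, tsum_pole_eq hκ _ (h a), hP]
    ring
  have hS := hs.prod
  have hE := ((summable_doubleErrorTerm m hτ z₁ z₂).prod).mul_left (π * I : ℂ)
  simp_rw [h1] at hS
  have hPs : Summable fun a => π * P a := by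
    have := hS.sub hE
    exact this.congr fun a => by ring
  have hphi : Phi₁ m τ z₁ z₂ 0 = ∑' a, I / 2 * P a := by
    rw [Phi₁, mul_zero, Complex.exp_zero, one_mul]
    exact tsum_congr fun a => Phi₁_term_eq m τ z₁ z₂ a (h a)
  rw [hs.tsum_prod, hphi, (hasSum_zwegersTerm m hτ z₁ z₂).tsum_eq]
  simp_rw [h1]
  rw [hPs.tsum_add hE, tsum_mul_left, tsum_mul_left, tsum_mul_left]
  field_simp
  linear_combination (∑' a : ℤ, ∑' r : ℤ, doubleErrorTerm m τ z₁ z₂ (a, r)) * I_sq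

theorem PhiMod_eq (m : ℕ) {τ : ℂ} (hτ : 0 < τ.im) (z₁ z₂ : ℂ)
    (h₁ : ∀ a : ℤ, z₁ + a * τ ∈ integerComplement)
    (h₂ : ∀ a : ℤ, z₂ + a * τ ∈ integerComplement) :
    PhiMod m τ z₁ z₂ 0 = I / (2 * π) *
      (∑' x, latticeTerm m τ z₁ z₂ x - ∑' x, latticeTerm m τ z₂ z₁ x) := by
  rw [mul_sub, tsum_latticeTerm m hτ z₁ z₂ h₁, tsum_latticeTerm m hτ z₂ z₁ h₂]
  have hA := (hasSum_zwegersTerm m hτ z₁ z₂).summable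
  have hB := (hasSum_zwegersTerm m hτ z₂ z₁).summable
  have hB' := (Equiv.subLeft (-1 : ℤ)).summable_iff.mpr hB
  have hB'' : ∀ r : ℤ, zwegersTerm m τ ((z₂ - z₁) / 2) (-1 - r) *
      thetaAlt (-1 * (((-1 - r : ℤ) : ℝ) + 1 / 2)) ((m : ℝ) + 1 / 2) τ (z₂ + z₁) =
      -(zwegersTerm m τ ((z₁ - z₂) / 2) r *
        thetaAlt (1 * ((r : ℝ) + 1 / 2)) ((m : ℝ) + 1 / 2) τ (z₁ + z₂)) := by
    intro r
    rw [show (z₂ - z₁) / 2 = -((z₁ - z₂) / 2) by ring, zwegersTerm_neg, add_comm z₂, neg_mul]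
    congr 3
    push_cast
    ring
  have hC : Summable fun r : ℤ => zwegersTerm m τ ((z₁ - z₂) / 2) r *
      thetaAlt (1 * ((r : ℝ) + 1 / 2)) ((m : ℝ) + 1 / 2) τ (z₁ + z₂) := by
    have := hB'.neg
    refine this.congr fun r => ?_
    simp only [Function.comp_apply, Equiv.subLeft_apply]
    rw [hB'', neg_neg]
  have hQ : ∑' r : ℤ, zwegersTerm m τ ((z₂ - z₁) / 2) r *
      thetaAlt (-1 * ((r : ℝ) + 1 / 2)) ((m : ℝ) + 1 / 2) τ (z₂ + z₁) =
      -∑' r : ℤ, zwegersTerm m τ ((z₁ - z₂) / 2) r *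
        thetaAlt (1 * ((r : ℝ) + 1 / 2)) ((m : ℝ) + 1 / 2) τ (z₁ + z₂) := by
    rw [← tsum_neg, ← (Equiv.subLeft (-1 : ℤ)).tsum_eq]
    exact tsum_congr hB''
  rw [hQ, tsum_zwegersTerm_mul_thetaAlt m _ _ (Or.inl rfl) hC,
    tsum_zwegersTerm_mul_thetaAlt m _ _ (Or.inr rfl) hA, PhiMod, Phi, PhiAdd]
  simp only [mul_add, Finset.sum_add_distrib, mul_zero, Complex.exp_zero, mul_one, one_mul,
    neg_one_mul]
  ring_nf

/-! ### The lattice sum of the functions `PsiMod` -/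

/-- The function of `A, B ∈ ℝ` whose weighted sum over a translate of `ℤ²` is
`PsiMod M m ε j k τ z (-z) 0`. -/
def charTerm (M m : ℕ) (τ z : ℂ) (A B : ℝ) : ℂ :=
  exp (π * I * (2 * m + 1) / M * (-A * z + (z + A * τ + B) *
    (z - conj z - conj (z + A * τ + B)) / (τ - conj τ))) / (z + A * τ + B)

/-- The weight with which `charTerm` enters the lattice sum of `PsiMod`. -/
def charWeight (M m : ℕ) (ε k : ℝ) (l n : ℤ) : ℂ :=
  (-1 : ℂ) ^ (l + n + l * n) * exp (π * I * (2 * m + 1) * (l * ε - k * (n + ε) / M))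

theorem sub_conj_ne_zero {τ : ℂ} (hτ : 0 < τ.im) : τ - conj τ ≠ 0 := by
  rw [sub_conj_eq]
  simp [hτ.ne']

theorem charTerm_S (M m : ℕ) {τ : ℂ} (hτ : 0 < τ.im) (z : ℂ) (A B : ℝ) :
    charTerm M m (-1 / τ) (z / τ) A B =
      τ * exp (-(π * I * (2 * m + 1) * z ^ 2 / (M * τ))) * charTerm M m τ z B (-A) := by
  have hτ0 : τ ≠ 0 := by
    rintro rfl
    simp at hτ
  have hτ1 : conj τ ≠ 0 := by simpa using hτ0
  have hd := sub_conj_ne_zero hτ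
  have h1 : z / τ + A * (-1 / τ) + B = (z + B * τ + ((-A : ℝ) : ℂ)) / τ := by
    field_simp
    push_cast
    ring
  have key : exp (π * I * (2 * m + 1) / M * (-A * (z / τ) + (z + B * τ + ((-A : ℝ) : ℂ)) / τ *
        (z / τ - conj (z / τ) - conj ((z + B * τ + ((-A : ℝ) : ℂ)) / τ)) /
          (-1 / τ - conj (-1 / τ)))) =
      exp (-(π * I * (2 * m + 1) * z ^ 2 / (M * τ))) *
        exp (π * I * (2 * m + 1) / M * (-B * z + (z + B * τ + ((-A : ℝ) : ℂ)) *
          (z - conj z - conj (z + B * τ + ((-A : ℝ) : ℂ))) / (τ - conj τ))) := by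
    rw [← Complex.exp_add]
    congr 1
    simp only [map_div₀, map_neg, map_one, map_add, map_mul, conj_ofReal]
    generalize conj z = z', conj τ = τ' at hd hτ1
    have hd' : -1 / τ - -1 / τ' = (τ - τ') / (τ * τ') := by
      field_simp
      ring
    rw [hd']
    push_cast
    field_simp
    ring
  simp only [charTerm, h1]
  rw [key, div_div_eq_mul_div]
  ring

theorem charTerm_T (M m : ℕ) (τ z : ℂ) (A B : ℝ) :
    charTerm M m (τ + 1) z A B = charTerm M m τ z A (A + B) := by
  have h1 : z + A * (τ + 1) + B = z + A * τ + ((A + B : ℝ) : ℂ) := by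
    push_cast
    ring
  have h2 : τ + 1 - conj (τ + 1) = τ - conj τ := by
    rw [map_add, map_one]
    ring
  simp only [charTerm, h1, h2]

theorem prefactor_mul_latticeTerm (M m : ℕ) (hM : M ≠ 0) {τ : ℂ} (hτ : 0 < τ.im) (z : ℂ)
    (ε j k : ℝ) (l n : ℤ) :
    qPow τ ((2 * m + 1) / (2 * M) * j * k) *
        exp (2 * π * I * (2 * m + 1) / (2 * M) * (k * z + j * -z)) *
        latticeTerm m (M * τ) (z + j * τ + ε) (-z + k * τ + ε) (l, n) =
      charWeight M m ε k l n * charTerm M m τ z (j + l * M) (n + ε) := by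
  have hd := sub_conj_ne_zero hτ
  have hM' : (M : ℂ) ≠ 0 := Nat.cast_ne_zero.mpr hM
  have h1 : z + j * τ + ε + l * (M * τ) + n =
      z + ((j + l * M : ℝ) : ℂ) * τ + ((n + ε : ℝ) : ℂ) := by
    push_cast
    ring
  simp only [charTerm, charWeight, latticeTerm, qPow, h1]
  rw [← mul_div_assoc, ← mul_div_assoc]
  congr 1
  rw [mul_left_comm, mul_assoc ((-1 : ℂ) ^ (l + n + l * n)), ← Complex.exp_add,
    ← Complex.exp_add, ← Complex.exp_add]
  congr 2
  simp only [map_neg, map_add, map_mul, conj_ofReal, Complex.conj_natCast]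
  generalize conj z = z', conj τ = τ' at hd
  have hd' : (M : ℂ) * τ - M * τ' = M * (τ - τ') := by ring
  rw [hd']
  push_cast
  field_simp
  ring

theorem prefactor_mul_latticeTerm_swap (M m : ℕ) (hM : M ≠ 0) {τ : ℂ} (hτ : 0 < τ.im) (z : ℂ)
    (ε j k : ℝ) (l n : ℤ) :
    qPow τ ((2 * m + 1) / (2 * M) * j * k) *
        exp (2 * π * I * (2 * m + 1) / (2 * M) * (k * z + j * -z)) *
        latticeTerm m (M * τ) (-z + k * τ + ε) (z + j * τ + ε) (l, n) =
      -(charWeight M m ε j l n * charTerm M m τ z (-(k + l * M)) (-(n + ε))) := by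
  have hd := sub_conj_ne_zero hτ
  have hM' : (M : ℂ) ≠ 0 := Nat.cast_ne_zero.mpr hM
  have h1 : -z + k * τ + ε + l * (M * τ) + n =
      -(z + ((-(k + l * M) : ℝ) : ℂ) * τ + ((-(n + ε) : ℝ) : ℂ)) := by
    push_cast
    ring
  simp only [charTerm, charWeight, latticeTerm, qPow, h1]
  rw [div_neg, mul_neg, neg_inj, ← mul_div_assoc, ← mul_div_assoc]
  congr 1
  rw [mul_left_comm, mul_assoc ((-1 : ℂ) ^ (l + n + l * n)), ← Complex.exp_add,
    ← Complex.exp_add, ← Complex.exp_add]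
  congr 2
  simp only [map_neg, map_add, map_mul, conj_ofReal, Complex.conj_natCast]
  generalize conj z = z', conj τ = τ' at hd
  have hd' : (M : ℂ) * τ - M * τ' = M * (τ - τ') := by ring
  rw [hd']
  push_cast
  field_simp
  ring

theorem PsiMod_eq (M m : ℕ) (hM : M ≠ 0) {τ : ℂ} (hτ : 0 < τ.im) (z : ℂ) (ε j k : ℝ)
    (h₁ : ∀ l n : ℤ, z + (j + l * M) * τ + (n + ε) ≠ 0)
    (h₂ : ∀ l n : ℤ, z - (k + l * M) * τ - (n + ε) ≠ 0) :
    ∃ S₁ S₂ : ℂ,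
      HasSum (fun x : ℤ × ℤ => charWeight M m ε k x.1 x.2 *
        charTerm M m τ z (j + x.1 * M) (x.2 + ε)) S₁ ∧
      HasSum (fun x : ℤ × ℤ => charWeight M m ε j x.1 x.2 *
        charTerm M m τ z (-(k + x.1 * M)) (-(x.2 + ε))) S₂ ∧
      PsiMod M m ε j k τ z (-z) 0 = I / (2 * π) * (S₁ + S₂) := by
  have hMτ : 0 < ((M : ℂ) * τ).im := by
    have : (0 : ℝ) < M := by exact_mod_cast Nat.pos_of_ne_zero hM
    simpa using mul_pos this hτ
  have hA := (summable_latticeTerm m hMτ (z + j * τ + ε) (-z + k * τ + ε)).hasSum.mul_left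
    (qPow τ ((2 * m + 1) / (2 * M) * j * k) *
        exp (2 * π * I * (2 * m + 1) / (2 * M) * (k * z + j * -z)))
  have hB := (summable_latticeTerm m hMτ (-z + k * τ + ε) (z + j * τ + ε)).hasSum.mul_left
    (-(qPow τ ((2 * m + 1) / (2 * M) * j * k) *
        exp (2 * π * I * (2 * m + 1) / (2 * M) * (k * z + j * -z))))
  refine ⟨_, _, hA.congr_fun fun x => (prefactor_mul_latticeTerm M m hM hτ z ε j k x.1 x.2).symm,
    hB.congr_fun fun x => ?_, ?_⟩
  · rw [neg_mul, prefactor_mul_latticeTerm_swap M m hM hτ z ε j k x.1 x.2, neg_neg]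
  · have e₁ : ∀ a : ℤ, z + j * τ + ε + a * (M * τ) ∈ integerComplement := by
      rintro a ⟨n, hn⟩
      apply h₁ a (-n)
      push_cast
      linear_combination -hn
    have e₂ : ∀ a : ℤ, -z + k * τ + ε + a * (M * τ) ∈ integerComplement := by
      rintro a ⟨n, hn⟩
      apply h₂ a (-n)
      push_cast
      linear_combination hn
    rw [PsiMod, zero_div, PhiMod_eq m hMτ _ _ e₁ e₂]
    ring

/-! ### The translation `τ ↦ τ + 1` -/

theorem neg_one_zpow_congr {a b c : ℤ} (h : a - b = 2 * c) : (-1 : ℂ) ^ a = (-1) ^ b := by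
  rw [show a = b + (c + c) by omega, zpow_add₀ (by norm_num), Even.neg_one_zpow ⟨c, rfl⟩, mul_one]

theorem exp_odd_mul_int (m : ℕ) (n : ℤ) : exp (π * I * (2 * m + 1) * n) = (-1 : ℂ) ^ n := by
  rw [← neg_one_zpow_mul_odd m n, neg_one_zpow_eq_exp]
  push_cast
  ring_nf

theorem charWeight_T (M m : ℕ) (hM : Odd M) {ε ε' ε'' j k : ℝ} {J K d : ℤ} (hj : j = ε' + J)
    (hk : k = ε' + K) (hJK : Even (J - K)) (hd : ε + ε' = ε'' + d) (l n : ℤ) :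
    charWeight M m ε k l n = (-1) ^ (J + d) * exp (π * I * (2 * m + 1) / M * (j * k)) *
      charWeight M m ε'' k l (n + (J + l * M + d)) := by
  have hM' : (M : ℂ) ≠ 0 := Nat.cast_ne_zero.mpr hM.pos.ne'
  have h1 : exp (π * I * (2 * m + 1) * (l * ε - k * (n + ε) / M)) =
      exp (π * I * (2 * m + 1) / M * (j * k)) *
      exp (π * I * (2 * m + 1) * (l * ε'' - k * ((n + (J + l * M + d) : ℤ) + ε'') / M)) *
        (-1 : ℂ) ^ (l * (d + K)) := by
    rw [← exp_odd_mul_int m, ← Complex.exp_add, ← Complex.exp_add]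
    congr 1
    have hε : (ε : ℂ) = ε'' + d - ε' := by
      rw [eq_sub_iff_add_eq]
      exact_mod_cast hd
    rw [hε, hj, hk]
    push_cast
    field_simp
    ring
  have h2 : (-1 : ℂ) ^ (l + n + l * n) * (-1 : ℂ) ^ (l * (d + K)) =
      (-1 : ℂ) ^ (J + d) * (-1 : ℂ) ^ (l + (n + (J + l * M + d)) + l * (n + (J + l * M + d))) := by
    rw [← zpow_add₀ (by norm_num), ← zpow_add₀ (by norm_num)]
    obtain ⟨μ, hμ⟩ := hM
    obtain ⟨ν, hν⟩ := hJK
    obtain ⟨lam, hlam⟩ := Int.even_mul_succ_self l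
    refine neg_one_zpow_congr (c := -(J + d + lam + μ * (l * (l + 1)) + l * ν)) ?_
    rw [hμ]
    have hJ : J = K + (ν + ν) := by omega
    rw [hJ]
    push_cast
    linear_combination (-1 : ℤ) * hlam
  rw [charWeight, charWeight, h1]
  linear_combination (exp (π * I * (2 * m + 1) / M * (j * k)) *
      exp (π * I * (2 * m + 1) * (l * ε'' - k * ((n + (J + l * M + d) : ℤ) + ε'') / M))) * h2

theorem hasSum_charTerm_T (M m : ℕ) (hM : Odd M) {τ z : ℂ} {ε ε' ε'' j k : ℝ} {J K d : ℤ}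
    (hj : j = ε' + J) (hk : k = ε' + K) (hJK : Even (J - K)) (hd : ε + ε' = ε'' + d) {S : ℂ}
    (δ : ℝ)
    (hS : HasSum (fun x : ℤ × ℤ => charWeight M m ε'' k x.1 x.2 *
        charTerm M m τ z (δ * (j + x.1 * M)) (δ * (x.2 + ε''))) S) :
    HasSum (fun x : ℤ × ℤ => charWeight M m ε k x.1 x.2 *
        charTerm M m (τ + 1) z (δ * (j + x.1 * M)) (δ * (x.2 + ε)))
      ((-1) ^ (J + d) * exp (π * I * (2 * m + 1) / M * (j * k)) * S) := by
  have h := ((Equiv.prodShear (Equiv.refl ℤ)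
    fun l : ℤ => Equiv.addRight (J + l * M + d)).hasSum_iff.mpr hS).mul_left
      ((-1) ^ (J + d) * exp (π * I * (2 * m + 1) / M * (j * k)))
  refine h.congr_fun fun x => ?_
  have h1 : δ * (j + x.1 * M) + δ * (x.2 + ε) =
      δ * (((x.2 + (J + x.1 * M + d) : ℤ) : ℝ) + ε'') := by
    rw [hj]
    push_cast
    linear_combination δ * hd
  rw [charTerm_T, h1, charWeight_T M m hM hj hk hJK hd]
  simp only [Function.comp_apply, Equiv.prodShear_apply, Equiv.refl_apply, Equiv.coe_addRight,
    mul_assoc]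

theorem PsiMod_T (M m : ℕ) (hM : Odd M) {τ : ℂ} (hτ : 0 < τ.im) (z : ℂ) {ε ε' ε'' j k : ℝ}
    {J K d : ℤ} (hj : j = ε' + J) (hk : k = ε' + K) (hJK : Even (J - K)) (hd : ε + ε' = ε'' + d)
    (h₁ : ∀ l n : ℤ, z + (j + l * M) * (τ + 1) + (n + ε) ≠ 0)
    (h₂ : ∀ l n : ℤ, z - (k + l * M) * (τ + 1) - (n + ε) ≠ 0) :
    PsiMod M m ε j k (τ + 1) z (-z) 0 =
      (-1) ^ (J + d) * exp (π * I * (2 * m + 1) / M * (j * k)) *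
        PsiMod M m ε'' j k τ z (-z) 0 := by
  have hM0 : M ≠ 0 := hM.pos.ne'
  have hd' : (ε : ℂ) + ε' = ε'' + d := by exact_mod_cast hd
  have hj' : (j : ℂ) = ε' + J := by exact_mod_cast hj
  have hk' : (k : ℂ) = ε' + K := by exact_mod_cast hk
  have h₁' : ∀ l n : ℤ, z + (j + l * M) * τ + (n + ε'') ≠ 0 := by
    intro l n h
    apply h₁ l (n - J - l * M - d)
    push_cast
    linear_combination h + hj' + hd'
  have h₂' : ∀ l n : ℤ, z - (k + l * M) * τ - (n + ε'') ≠ 0 := by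
    intro l n h
    apply h₂ l (n - K - l * M - d)
    push_cast
    linear_combination h - hk' - hd'
  obtain ⟨S₁, S₂, hS₁, hS₂, hS⟩ :=
    PsiMod_eq M m hM0 (τ := τ + 1) (by simpa using hτ) z ε j k h₁ h₂
  obtain ⟨T₁, T₂, hT₁, hT₂, hT⟩ := PsiMod_eq M m hM0 hτ z ε'' j k h₁' h₂'
  have hJK' : Even (K - J) := by
    rw [← neg_sub]
    exact hJK.neg
  have hA := hasSum_charTerm_T (τ := τ) (z := z) (S := T₁) M m hM hj hk hJK hd 1
    (by simpa only [one_mul] using hT₁)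
  have hB := hasSum_charTerm_T (τ := τ) (z := z) (S := T₂) M m hM hk hj hJK' hd (-1)
    (by simpa only [neg_one_mul] using hT₂)
  simp only [one_mul] at hA
  simp only [neg_one_mul] at hB
  obtain ⟨ν, hν⟩ := hJK'
  rw [hS, hT, hS₁.unique hA, hS₂.unique hB,
    neg_one_zpow_congr (show K + d - (J + d) = 2 * ν by omega), mul_comm (k : ℂ)]
  ring

theorem exists_int_of_mem_Omega {M : ℕ} {ε : ℝ} {x : ℝ × ℝ} (hx : x ∈ Omega M ε) :
    ∃ J K : ℤ, x.1 = ε + J ∧ x.2 = ε + K ∧ Even (J - K) := by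
  rw [Omega, Set.Finite.mem_toFinset] at hx
  obtain ⟨⟨J, hJ⟩, ⟨K, hK⟩, -, -, -, -, n, hn⟩ := hx
  refine ⟨J, K, hJ, hK, n, ?_⟩
  rw [hJ, hK] at hn
  have : ((J - K : ℤ) : ℝ) = ((n + n : ℤ) : ℝ) := by
    push_cast
    linarith
  exact_mod_cast this

theorem chMod_T (M m : ℕ) (hM : Odd M) {ε ε' : ℝ} (hε : ε = 0 ∨ ε = 1 / 2)
    (hε' : ε' = 0 ∨ ε' = 1 / 2) (hne : ε + ε' ≠ 0) {j k : ℝ} (hjk : (j, k) ∈ Omega M ε')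
    {τ z : ℂ} (hτ : 0 < τ.im) (hreg : IsRegular ε ε' (τ + 1) z) :
    chMod M m ε ε' j k (τ + 1) z =
      exp (-(π * I * (j + 1 / 12 - ε' / 4 + 4 * ε * ε'))) *
        exp (2 * π * I * (2 * m + 1) / (2 * M) * (j * k)) * chMod M m |ε - ε'| ε' j k τ z := by
  obtain ⟨J, K, hj, hk, hJK⟩ := exists_int_of_mem_Omega hjk
  simp only at hj hk
  obtain ⟨d, hd, hd'⟩ : ∃ d : ℤ, ε + ε' = |ε - ε'| + d ∧ (4 * ε * ε' : ℂ) = d := by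
    rcases hε with rfl | rfl <;> rcases hε' with rfl | rfl
    · simp at hne
    · exact ⟨0, by norm_num, by norm_num⟩
    · exact ⟨0, by norm_num, by norm_num⟩
    · exact ⟨1, by norm_num, by norm_num⟩
  obtain ⟨e, he⟩ : ∃ e : ℤ, (2 * ε : ℂ) = e := by
    rcases hε with rfl | rfl
    · exact ⟨0, by norm_num⟩
    · exact ⟨1, by norm_num⟩
  obtain ⟨e', he'⟩ : ∃ e : ℤ, (2 * ε' : ℂ) = e := by
    rcases hε' with rfl | rfl
    · exact ⟨0, by norm_num⟩
    · exact ⟨1, by norm_num⟩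
  have hj' : (j : ℂ) = ε' + J := by exact_mod_cast hj
  have hk' : (k : ℂ) = ε' + K := by exact_mod_cast hk
  have hP := PsiMod_T M m hM hτ z hj hk hJK hd
    (fun l n h => (hreg (-e - n) (-e' - J - l * M)).2 (by
      push_cast
      rw [hj'] at h
      linear_combination h - he - (τ + 1) * he'))
    (fun l n h => (hreg n (K + l * M)).2 (by
      push_cast
      rw [hk'] at h
      linear_combination h))
  have hM' : (M : ℂ) ≠ 0 := Nat.cast_ne_zero.mpr hM.pos.ne'
  rw [chMod, chMod, hP, R3_T hε hε' hne hτ, ← neg_one_zpow_neg, neg_one_zpow_eq_exp,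
    div_eq_mul_inv _ (_ * R3 _ _ _ _), div_eq_mul_inv _ (R3 _ _ _ _), mul_inv, ← Complex.exp_neg]
  have key : exp (π * I * (-(J + d) : ℤ)) * exp (-(π * I * (1 / 12 + 3 * ε' / 4))) *
      exp (π * I * (2 * m + 1) / M * (j * k)) =
      exp (-(π * I * (j + 1 / 12 - ε' / 4 + 4 * ε * ε'))) *
        exp (2 * π * I * (2 * m + 1) / (2 * M) * (j * k)) := by
    rw [← Complex.exp_add, ← Complex.exp_add, ← Complex.exp_add]
    congr 1
    rw [hd', hj']
    push_cast
    field_simp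
    ring
  rw [← key]
  ring

/-! ### Finite trigonometric sums -/

theorem geom_sum_eq_symmetric_sum {ζ : ℂ} (hζ : ζ ≠ 0) (h : ℕ) :
    ∑ k ∈ Finset.range (2 * h + 1), ζ ^ k =
      ζ ^ h * (1 + ∑ i ∈ Finset.range h, (ζ ^ (i + 1) + (ζ ^ (i + 1))⁻¹)) := by
  induction h with
  | zero => simp
  | succ h ih =>
    rw [show 2 * (h + 1) + 1 = 2 * h + 1 + 1 + 1 by ring, geom_sum_succ', geom_sum_succ, ih,
      Finset.sum_range_succ]
    have : ζ ^ (h + 1) ≠ 0 := pow_ne_zero _ hζ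
    field_simp
    ring

theorem exp_two_pi_mul_div_eq_one_iff {M m : ℕ} (hM : M ≠ 0) (hcop : Nat.Coprime M (2 * m + 1))
    (r : ℤ) : exp (2 * (π * I * (2 * m + 1) / M * r)) = 1 ↔ (M : ℤ) ∣ r := by
  have hM' : (M : ℂ) ≠ 0 := Nat.cast_ne_zero.mpr hM
  have hpi : (π : ℂ) ≠ 0 := by exact_mod_cast Real.pi_ne_zero
  rw [Complex.exp_eq_one_iff]
  constructor
  · rintro ⟨n, hn⟩
    have h1 : ((2 * m + 1 : ℂ)) * r = M * n := by
      have h2 : (2 * π * I : ℂ) ≠ 0 := Complex.two_pi_I_ne_zero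
      field_simp at hn
      linear_combination hn
    have h2 : ((2 * m + 1 : ℕ) : ℤ) * r = M * n := by exact_mod_cast h1
    exact (Nat.isCoprime_iff_coprime.mpr hcop).dvd_of_dvd_mul_left ⟨n, h2⟩
  · rintro ⟨n, rfl⟩
    refine ⟨(2 * m + 1) * n, ?_⟩
    push_cast
    field_simp

theorem sum_exp_even {M m h : ℕ} (hM : M = 2 * h + 1) (hcop : Nat.Coprime M (2 * m + 1))
    (r : ℤ) :
    ∑ i ∈ Finset.range h, (exp (π * I * (2 * m + 1) / M * (2 * i + 2 : ℤ) * r) +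
      exp (-(π * I * (2 * m + 1) / M * (2 * i + 2 : ℤ) * r))) =
      M * (if (M : ℤ) ∣ r then 1 else 0) - 1 := by
  have hM0 : M ≠ 0 := by omega
  have hM' : (M : ℂ) ≠ 0 := Nat.cast_ne_zero.mpr hM0
  set ζ : ℂ := exp (2 * (π * I * (2 * m + 1) / M * r)) with hζ
  have hζ0 : ζ ≠ 0 := Complex.exp_ne_zero _
  have hpow : ∀ i : ℕ, ζ ^ (i + 1) = exp (π * I * (2 * m + 1) / M * (2 * i + 2 : ℤ) * r) := by
    intro i
    rw [hζ, ← Complex.exp_nat_mul]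
    congr 1
    push_cast
    ring
  simp only [Complex.exp_neg, ← hpow]
  have hsum := geom_sum_eq_symmetric_sum hζ0 h
  rw [← hM] at hsum
  split_ifs with hr
  · have h1 : ζ = 1 := (exp_two_pi_mul_div_eq_one_iff hM0 hcop r).mpr hr
    rw [h1] at hsum ⊢
    simp only [one_pow, Finset.sum_const, Finset.card_range, nsmul_eq_mul, mul_one, one_mul] at hsum ⊢
    linear_combination -hsum
  · have h1 : ζ ≠ 1 := fun h1 => hr ((exp_two_pi_mul_div_eq_one_iff hM0 hcop r).mp h1)
    have h2 : ζ ^ M = 1 := by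
      rw [hζ, ← Complex.exp_nat_mul, Complex.exp_eq_one_iff]
      refine ⟨(2 * m + 1) * r, ?_⟩
      push_cast
      field_simp
    rw [geom_sum_eq h1, h2, sub_self, zero_div, eq_comm, mul_eq_zero] at hsum
    have h3 := hsum.resolve_left (pow_ne_zero _ hζ0)
    linear_combination h3

theorem sum_exp_parity {M m h : ℕ} (hM : M = 2 * h + 1) (hcop : Nat.Coprime M (2 * m + 1))
    {e : ℤ} (he : e = 0 ∨ e = 1) (r : ℤ) :
    ∑ i ∈ Finset.range h, (exp (π * I * (2 * m + 1) / M * (2 * i + 2 - e : ℤ) * r) +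
      exp (-(π * I * (2 * m + 1) / M * (2 * i + 2 - e : ℤ) * r))) =
      (-1) ^ (e * r) * (M * (if (M : ℤ) ∣ r then 1 else 0) - 1) := by
  rw [← sum_exp_even hM hcop r]
  rcases he with rfl | rfl
  · simp
  · have hM' : (M : ℂ) ≠ 0 := Nat.cast_ne_zero.mpr (by omega)
    have hMh : (M : ℂ) = 2 * h + 1 := by exact_mod_cast hM
    rw [← Finset.sum_range_reflect, Finset.mul_sum]
    refine Finset.sum_congr rfl fun i hi => ?_
    have hi' : i + 1 ≤ h := Finset.mem_range.mp hi
    have hcast : ((h - 1 - i : ℕ) : ℤ) = h - 1 - i := by omega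
    rw [hcast, one_mul, mul_add ((-1 : ℂ) ^ r), add_comm]
    congr 1
    · rw [← neg_one_zpow_neg, ← exp_odd_mul_int m, ← Complex.exp_add]
      congr 1
      push_cast
      field_simp
      rw [hMh]
      ring
    · rw [← exp_odd_mul_int m, ← Complex.exp_add]
      congr 1
      push_cast
      field_simp
      rw [hMh]
      ring

theorem sum_range_ite_dvd {M : ℕ} (hM : M ≠ 0) (c : ℤ) (f : ℤ → ℂ) (v : ℂ)
    (hf : ∀ K : ℤ, (M : ℤ) ∣ c + K → f K = v) :
    ∑ K ∈ Finset.range M, (if (M : ℤ) ∣ c + K then f K else 0) = v := by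
  have hM' : (0 : ℤ) < M := by omega
  have h0 := Int.emod_nonneg (-c) hM'.ne'
  have h1 := Int.emod_lt_of_pos (-c) hM'
  have hdiv : (M : ℤ) ∣ c + ((-c % M).toNat : ℤ) := by
    rw [Int.toNat_of_nonneg h0]
    exact ⟨-(-c / M), by linear_combination Int.emod_add_mul_ediv (-c) M⟩
  rw [Finset.sum_eq_single (-c % M).toNat, if_pos hdiv, hf _ hdiv]
  · intro K hK hne
    refine if_neg fun hd => hne ?_
    have h2 := dvd_sub hd hdiv
    rw [add_sub_add_left_eq_sub, Int.toNat_of_nonneg h0] at h2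
    have hK' : (K : ℤ) < M := by exact_mod_cast Finset.mem_range.mp hK
    have := Int.eq_zero_of_abs_lt_dvd h2 (by rw [abs_lt]; omega)
    omega
  · intro hn
    exact absurd (Finset.mem_range.mpr (by omega)) hn

/-! ### The index set and the matrix -/

theorem sum_Omega {M h : ℕ} (hM : M = 2 * h + 1) {e : ℤ} (he : e = 0 ∨ e = 1)
    (f : ℝ × ℝ → ℂ) :
    ∑ x ∈ Omega M ((e : ℝ) / 2), f x = ∑ i ∈ Finset.range h, ∑ K ∈ Finset.range M,
      f ((e : ℝ) / 2 + (2 * i + 2 - e - K - e : ℤ), (e : ℝ) / 2 + (K : ℤ)) := by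
  rw [← Finset.sum_product', eq_comm]
  have he0 : (0 : ℝ) ≤ e ∧ (e : ℝ) ≤ 1 := by rcases he with rfl | rfl <;> simp
  have hMr : (M : ℝ) = 2 * h + 1 := by exact_mod_cast hM
  refine Finset.sum_nbij (fun x : ℕ × ℕ =>
    ((e : ℝ) / 2 + (2 * x.1 + 2 - e - x.2 - e : ℤ), (e : ℝ) / 2 + (x.2 : ℤ))) ?_ ?_ ?_ ?_
  · rintro ⟨i, K⟩ hx
    simp only [Finset.mem_product, Finset.mem_range] at hx
    obtain ⟨hi, hK⟩ := hx
    have hi' : (i : ℝ) + 1 ≤ h := by exact_mod_cast hi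
    have hK' : (K : ℝ) + 1 ≤ M := by exact_mod_cast hK
    have hi0 : (0 : ℝ) ≤ i := i.cast_nonneg
    have hK0 : (0 : ℝ) ≤ K := K.cast_nonneg
    rw [Omega, Set.Finite.mem_toFinset]
    refine ⟨⟨_, rfl⟩, ⟨_, rfl⟩, ?_, ?_, ?_, ?_, (i + 1 - e - K : ℤ), ?_⟩ <;> push_cast <;>
      linarith [he0.1, he0.2]
  · rintro ⟨i, K⟩ - ⟨i', K'⟩ - hx
    simp only [Prod.mk.injEq, add_right_inj, Int.cast_inj, Nat.cast_inj] at hx ⊢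
    omega
  · rintro ⟨a, b⟩ hx
    rw [Finset.mem_coe, Omega, Set.Finite.mem_toFinset] at hx
    obtain ⟨⟨J, hJ⟩, ⟨K, hK⟩, h1, h2, h3, h4, n, hn⟩ := hx
    simp only at hJ hK h1 h2 h3 h4 hn
    subst hJ hK
    have hJK : J - K = 2 * n := by
      have : ((J - K : ℤ) : ℝ) = ((2 * n : ℤ) : ℝ) := by
        push_cast
        linarith
      exact_mod_cast this
    have hK0 : 0 ≤ K := by
      have : ((-1 : ℤ) : ℝ) < K := by
        push_cast
        linarith [he0.2]
      have := Int.cast_lt.mp this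
      omega
    have hKM : K < M := by
      have : (K : ℝ) < ((M : ℤ) : ℝ) := by
        push_cast
        linarith [he0.1]
      exact_mod_cast this
    have h3' : 0 < e + J + K := by
      have : ((0 : ℤ) : ℝ) < ((e + J + K : ℤ) : ℝ) := by
        push_cast
        linarith
      exact_mod_cast this
    have h4' : e + J + K < M := by
      have : ((e + J + K : ℤ) : ℝ) < ((M : ℤ) : ℝ) := by
        push_cast
        linarith
      exact_mod_cast this
    refine ⟨((n + K + e - 1).toNat, K.toNat), ?_, ?_⟩
    · simp only [Finset.coe_product, Finset.coe_range, Set.mem_prod, Set.mem_Iio]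
      omega
    · have h5 : (((n + K + e - 1).toNat : ℕ) : ℤ) = n + K + e - 1 := by omega
      have h6 : ((K.toNat : ℕ) : ℤ) = K := by omega
      simp only [h5, h6, Prod.mk.injEq, add_right_inj, Int.cast_inj, and_true]
      omega
  · intro x _
    rfl

theorem SMatrix_eq (M m : ℕ) {e e' : ℤ} (he : e = 0 ∨ e = 1) (he' : e' = 0 ∨ e' = 1)
    (hne : e + e' ≠ 0) (J K P L : ℤ) :
    SMatrix M m ((e' : ℝ) / 2) ((e : ℝ) / 2) ((e' : ℝ) / 2 + J, (e' : ℝ) / 2 + K)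
        ((e : ℝ) / 2 + (P - L - e : ℤ), (e : ℝ) / 2 + L) =
      1 / M * (-1) ^ (e + 1) *
        exp (π * I * (2 * m + 1) / M * ((P - e - 2 * L) * (J - K) / 2)) *
        (exp (π * I * (2 * m + 1) / M * (P * (J + K + e') / 2)) + (-1) ^ (e + e') *
          exp (-(π * I * (2 * m + 1) / M * (P * (J + K + e') / 2)))) := by
  have hphase : π * I * (2 * m + 1) / (2 * M) *
      ((((e : ℝ) / 2 + (P - L - e : ℤ) : ℝ) : ℂ) - (((e : ℝ) / 2 + L : ℝ) : ℂ)) *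
      ((((e' : ℝ) / 2 + J : ℝ) : ℂ) - (((e' : ℝ) / 2 + K : ℝ) : ℂ)) =
      π * I * (2 * m + 1) / M * ((P - e - 2 * L) * (J - K) / 2) := by
    push_cast
    ring
  have hangle : ((((2 * m + 1) / (2 * M) * (((e : ℝ) / 2 + (P - L - e : ℤ)) + ((e : ℝ) / 2 + L)) *
      (((e' : ℝ) / 2 + J) + ((e' : ℝ) / 2 + K)) * π : ℝ)) : ℂ) * I =
      π * I * (2 * m + 1) / M * (P * (J + K + e') / 2) := by
    push_cast
    ring
  simp only [SMatrix, hphase, Complex.ofReal_cos, Complex.ofReal_sin, Complex.cos, Complex.sin,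
    neg_mul, hangle]
  generalize exp (π * I * (2 * m + 1) / M * ((P - e - 2 * L) * (J - K) / 2)) = X
  generalize exp (π * I * (2 * m + 1) / M * (P * (J + K + e') / 2)) = Y
  generalize exp (-(π * I * (2 * m + 1) / M * (P * (J + K + e') / 2))) = Z
  rcases he with rfl | rfl <;> rcases he' with rfl | rfl
  · simp at hne
  · norm_num
    linear_combination (X * (Z - Y) / M) * I_sq
  · norm_num
    linear_combination (X * (Z - Y) / M) * I_sq
  · norm_num
    ring

/-! ### The coefficients of the lattice sum over a full translate of `ℤ²` -/

/-- The coefficient of `charTerm M m τ z (e'/2 + p) (e/2 + n)` in the lattice sum of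
`PsiMod M m (e/2) (e'/2 + J) (e'/2 + K) τ z (-z) 0`. -/
def latticeCoef (M m : ℕ) (e e' J K p n : ℤ) : ℂ :=
  (if (M : ℤ) ∣ p - J then
    charWeight M m ((e : ℝ) / 2) ((e' : ℝ) / 2 + K) ((p - J) / M) n else 0) +
  (if (M : ℤ) ∣ p + e' + K then
    charWeight M m ((e : ℝ) / 2) ((e' : ℝ) / 2 + J) (-((p + e' + K) / M)) (-n - e) else 0)

theorem hasSum_latticeCoef (M m : ℕ) (hM : M ≠ 0) {τ z : ℂ} (hτ : 0 < τ.im) (e e' J K : ℤ)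
    (hreg : ∀ p r : ℤ, z + ((e' : ℝ) / 2 + p : ℝ) * τ + ((e : ℝ) / 2 + r : ℝ) ≠ 0) :
    HasSum (fun x : ℤ × ℤ => latticeCoef M m e e' J K x.1 x.2 *
        charTerm M m τ z ((e' : ℝ) / 2 + x.1) ((e : ℝ) / 2 + x.2))
      (-2 * π * I * PsiMod M m ((e : ℝ) / 2) ((e' : ℝ) / 2 + J) ((e' : ℝ) / 2 + K) τ z (-z) 0) := by
  have hM' : (M : ℤ) ≠ 0 := by exact_mod_cast hM
  obtain ⟨S₁, S₂, hS₁, hS₂, hS⟩ := PsiMod_eq M m hM hτ z ((e : ℝ) / 2) ((e' : ℝ) / 2 + J)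
    ((e' : ℝ) / 2 + K)
    (fun l n h => hreg (J + l * M) n (by
      push_cast at h ⊢
      linear_combination h))
    (fun l n h => hreg (-e' - K - l * M) (-n - e) (by
      push_cast at h ⊢
      linear_combination h))
  have hpi : (π : ℂ) ≠ 0 := by exact_mod_cast Real.pi_ne_zero
  have hval : -2 * π * I * PsiMod M m ((e : ℝ) / 2) ((e' : ℝ) / 2 + J) ((e' : ℝ) / 2 + K) τ z (-z) 0
      = S₁ + S₂ := by
    rw [hS]
    field_simp
    linear_combination (-(S₁ + S₂)) * I_sq
  rw [hval]
  simp only [latticeCoef, add_mul]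
  have hinj₁ : Function.Injective fun x : ℤ × ℤ => (J + x.1 * M, x.2) := by
    rintro ⟨a, b⟩ ⟨c, d⟩ h
    simp only [Prod.mk.injEq, add_right_inj, mul_eq_mul_right_iff, hM', or_false] at h ⊢
    exact h
  have hinj₂ : Function.Injective fun x : ℤ × ℤ => (-e' - K - x.1 * M, -x.2 - e) := by
    rintro ⟨a, b⟩ ⟨c, d⟩ h
    simp only [Prod.mk.injEq, sub_right_inj, mul_eq_mul_right_iff, hM', or_false] at h ⊢
    exact ⟨h.1, by omega⟩
  refine HasSum.add ((hinj₁.hasSum_iff ?_).mp ?_) ((hinj₂.hasSum_iff ?_).mp ?_)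
  · rintro ⟨p, n⟩ hp
    rw [if_neg, zero_mul]
    rintro ⟨l, hl⟩
    exact hp ⟨(l, n), by simp only [Prod.mk.injEq, and_true]; linear_combination -hl⟩
  · refine hS₁.congr_fun fun x => ?_
    simp only [Function.comp_apply]
    rw [show J + x.1 * M - J = x.1 * M by ring, if_pos (dvd_mul_left _ _), Int.mul_ediv_cancel _ hM']
    congr 2
    · push_cast
      ring
    · ring
  · rintro ⟨p, n⟩ hp
    rw [if_neg, zero_mul]
    rintro ⟨l, hl⟩
    refine hp ⟨(-l, -n - e), ?_⟩
    simp only [Prod.mk.injEq]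
    exact ⟨by linear_combination -hl, by ring⟩
  · refine hS₂.congr_fun fun x => ?_
    simp only [Function.comp_apply]
    rw [show -e' - K - x.1 * M + e' + K = -x.1 * M by ring, if_pos (dvd_mul_left _ _),
      Int.mul_ediv_cancel _ hM', neg_neg, show -(-x.2 - e) - e = x.2 by ring]
    congr 2
    · push_cast
      ring
    · push_cast
      ring

theorem sign_mul_exp_congr {m : ℕ} {a b : ℤ} {x y : ℂ} (c d : ℤ)
    (h : x = y + π * I * (2 * m + 1) * c) (h2 : a + c - b = 2 * d) :
    (-1 : ℂ) ^ a * exp x = (-1) ^ b * exp y := by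
  rw [h, Complex.exp_add, exp_odd_mul_int, ← neg_one_zpow_congr h2, zpow_add₀ (by norm_num)]
  ring

/-- The first part of `latticeCoef`, weighted by the phases of `SMatrix` and summed over the
indices `(a, b)` with fixed `P = a + b`. -/
theorem sum_weight_left {M h : ℕ} (m : ℕ) (hM : M = 2 * h + 1) (e e' J K P p n : ℤ)
    (hJK : Even (J - K)) :
    ∑ L ∈ Finset.range M, exp (π * I * (2 * m + 1) / M * ((P - e - 2 * (L : ℤ)) * (J - K) / 2)) *
      ((-1) ^ (P - L - e) * (if (M : ℤ) ∣ p - (P - L - e) then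
        charWeight M m ((e' : ℝ) / 2) ((e : ℝ) / 2 + (L : ℤ)) ((p - (P - L - e)) / M) n else 0)) =
    (-1) ^ (p + n) * exp (π * I * (2 * m + 1) / M * ((e + 2 * p - P) * (J - K) / 2 -
      (P - e / 2 - p) * (e' / 2 + n))) := by
  have hM0 : M ≠ 0 := by omega
  have hM' : (M : ℂ) ≠ 0 := Nat.cast_ne_zero.mpr hM0
  have hMz : (M : ℤ) ≠ 0 := by exact_mod_cast hM0
  refine Eq.trans (Finset.sum_congr rfl fun L _ => ?_) (sum_range_ite_dvd hM0 (p - P + e)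
    (fun L : ℤ => exp (π * I * (2 * m + 1) / M * ((P - e - 2 * L) * (J - K) / 2)) *
      ((-1) ^ (P - L - e) *
        charWeight M m ((e' : ℝ) / 2) ((e : ℝ) / 2 + L) ((p - (P - L - e)) / M) n)) _ ?_)
  · rw [show p - (P - L - e) = p - P + e + L by ring]
    simp only [mul_ite, mul_zero]
  · rintro L ⟨l, hl⟩
    rw [show p - (P - L - e) = l * M by linear_combination hl, Int.mul_ediv_cancel _ hMz,
      charWeight]
    have hL : L = P - p - e + M * l := by linear_combination hl
    have hLc : (L : ℂ) = P - p - e + M * l := by exact_mod_cast congrArg (Int.cast (R := ℂ)) hL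
    obtain ⟨ν, hν⟩ := hJK
    have hνc : (J : ℂ) - K = 2 * ν := by
      have : J - K = 2 * ν := by omega
      exact_mod_cast congrArg (Int.cast (R := ℂ)) this
    rw [mul_left_comm, mul_left_comm (exp _), ← mul_assoc, ← zpow_add₀ (by norm_num),
      ← Complex.exp_add]
    refine sign_mul_exp_congr (m := m) (-(2 * l * ν) - l * n) (-(l * h) - l * ν) ?_ ?_
    · push_cast
      rw [hνc, hLc]
      field_simp
      ring
    · rw [hL, hM]
      push_cast
      ring

/-- The second part of `latticeCoef`, weighted by the phases of `SMatrix` and summed over the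
indices `(a, b)` with fixed `P = a + b`. -/
theorem sum_weight_right {M h : ℕ} (m : ℕ) (hM : M = 2 * h + 1) (e e' J K P p n : ℤ)
    (hJK : Even (J - K)) (hP : Even (P - e)) :
    ∑ L ∈ Finset.range M, exp (π * I * (2 * m + 1) / M * ((P - e - 2 * (L : ℤ)) * (J - K) / 2)) *
      ((-1) ^ (P - L - e) * (if (M : ℤ) ∣ p + e + L then
        charWeight M m ((e' : ℝ) / 2) ((e : ℝ) / 2 + (P - L - e : ℤ)) (-((p + e + L) / M))
          (-n - e') else 0)) =
    (-1) ^ (p + n + e + e') * exp (π * I * (2 * m + 1) / M * ((e + 2 * p + P) * (J - K) / 2 +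
      (P + e / 2 + p) * (e' / 2 + n))) := by
  have hM0 : M ≠ 0 := by omega
  have hM' : (M : ℂ) ≠ 0 := Nat.cast_ne_zero.mpr hM0
  have hMz : (M : ℤ) ≠ 0 := by exact_mod_cast hM0
  refine Eq.trans (Finset.sum_congr rfl fun L _ => ?_) (sum_range_ite_dvd hM0 (p + e)
    (fun L : ℤ => exp (π * I * (2 * m + 1) / M * ((P - e - 2 * L) * (J - K) / 2)) *
      ((-1) ^ (P - L - e) * charWeight M m ((e' : ℝ) / 2) ((e : ℝ) / 2 + (P - L - e : ℤ))
        (-((p + e + L) / M)) (-n - e'))) _ ?_)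
  · simp only [mul_ite, mul_zero]
  · rintro L ⟨l, hl⟩
    rw [hl, Int.mul_ediv_cancel_left _ hMz, charWeight]
    have hL : L = M * l - p - e := by linear_combination hl
    have hLc : (L : ℂ) = M * l - p - e := by exact_mod_cast congrArg (Int.cast (R := ℂ)) hL
    obtain ⟨ν, hν⟩ := hJK
    obtain ⟨π', hπ'⟩ := hP
    have hνc : (J : ℂ) - K = 2 * ν := by
      have : J - K = 2 * ν := by omega
      exact_mod_cast congrArg (Int.cast (R := ℂ)) this
    rw [mul_left_comm, mul_left_comm (exp _), ← mul_assoc, ← zpow_add₀ (by norm_num),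
      ← Complex.exp_add]
    refine sign_mul_exp_congr (m := m) (-(2 * l * ν) - l * (n + e')) (π' - l * h - l - l * ν - n - e') ?_ ?_
    · push_cast
      rw [hνc, hLc]
      field_simp
      ring
    · rw [hL, hM]
      push_cast
      linear_combination hπ'

theorem neg_one_zpow_mul_charWeight_left {M h : ℕ} (m : ℕ) (hM : M = 2 * h + 1)
    (e e' J K p n : ℤ) (hp : (M : ℤ) ∣ p - J) :
    (-1) ^ J * charWeight M m ((e : ℝ) / 2) ((e' : ℝ) / 2 + K) ((p - J) / M) n =
      (-1) ^ (e + (n - p - e') + (e + e') + e * (J - p)) *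
        exp (π * I * (2 * m + 1) / M * ((e / 2 + n) * (J - K - e' / 2 - p))) := by
  have hM' : (M : ℂ) ≠ 0 := Nat.cast_ne_zero.mpr (by omega)
  have hMz : (M : ℤ) ≠ 0 := by omega
  obtain ⟨l, hl⟩ := hp
  obtain rfl : p = M * l + J := by linear_combination hl
  rw [hl, Int.mul_ediv_cancel_left _ hMz, charWeight, ← mul_assoc, ← zpow_add₀ (by norm_num)]
  refine sign_mul_exp_congr (m := m) (l * (e + n))
    (J + l * (h + 1) + l * n + l * e * (h + 1) - e) ?_ ?_
  · push_cast
    field_simp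
    ring
  · rw [hM]
    push_cast
    ring

theorem neg_one_zpow_mul_charWeight_right {M h : ℕ} (m : ℕ) (hM : M = 2 * h + 1)
    (e e' J K p n : ℤ) (hJK : Even (J - K)) (hp : (M : ℤ) ∣ p + e' + K) :
    (-1) ^ J * charWeight M m ((e : ℝ) / 2) ((e' : ℝ) / 2 + J) (-((p + e' + K) / M)) (-n - e) =
      (-1) ^ (e + (n - p - e') + e * (p + e' + K)) *
        exp (π * I * (2 * m + 1) / M * ((e / 2 + n) * (J - K - e' / 2 - p))) := by
  have hM' : (M : ℂ) ≠ 0 := Nat.cast_ne_zero.mpr (by omega)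
  have hMz : (M : ℤ) ≠ 0 := by omega
  obtain ⟨q, hq⟩ := hp
  obtain ⟨ν, hν⟩ := hJK
  obtain rfl : p = M * q - e' - K := by linear_combination hq
  rw [hq, Int.mul_ediv_cancel_left _ hMz, charWeight, ← mul_assoc, ← zpow_add₀ (by norm_num)]
  refine sign_mul_exp_congr (m := m) (q * n) (ν + q * h - n - e + q * n - q * e * h) ?_ ?_
  · push_cast
    field_simp
    ring
  · rw [hM]
    push_cast
    linear_combination hν

theorem neg_one_zpow_sq (a : ℤ) : ((-1 : ℂ) ^ a) ^ 2 = 1 := by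
  rw [← zpow_natCast, ← zpow_mul]
  exact Even.neg_one_zpow ⟨a, by push_cast; ring⟩

/-- The matrix-weighted coefficients, summed over the indices `(a, b)` with fixed `P = a + b`. -/
theorem sum_SMatrix_mul_latticeCoef {M h : ℕ} (m : ℕ) (hM : M = 2 * h + 1)
    {e e' : ℤ} (he : e = 0 ∨ e = 1) (he' : e' = 0 ∨ e' = 1) (hne : e + e' ≠ 0) {J K : ℤ}
    (hJK : Even (J - K)) (p n P : ℤ) (hP : Even (P - e)) :
    ∑ L ∈ Finset.range M,
      SMatrix M m ((e' : ℝ) / 2) ((e : ℝ) / 2) ((e' : ℝ) / 2 + J, (e' : ℝ) / 2 + K)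
        ((e : ℝ) / 2 + (P - L - e : ℤ), (e : ℝ) / 2 + (L : ℤ)) *
      ((-1) ^ (P - L - e : ℤ) * latticeCoef M m e' e (P - L - e) L n (-p - e')) =
      1 / M * (-1) ^ (e + 1) * (-1) ^ (n - p - e') *
        exp (π * I * (2 * m + 1) / M * ((e / 2 + n) * (J - K - e' / 2 - p))) *
      ((exp (π * I * (2 * m + 1) / M * P * (p + e' + K : ℤ)) +
        exp (-(π * I * (2 * m + 1) / M * P * (p + e' + K : ℤ)))) +
        (-1) ^ (e + e') * (exp (π * I * (2 * m + 1) / M * P * (J - p : ℤ)) +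
        exp (-(π * I * (2 * m + 1) / M * P * (J - p : ℤ))))) := by
  set u : ℂ := π * I * (2 * m + 1) / M with hu
  have hL := sum_weight_left m hM e e' J K P n (-p - e') hJK
  have hR := sum_weight_right m hM e e' J K P n (-p - e') hJK hP
  rw [← hu] at hL hR
  set A := exp (u * ((e / 2 + n) * (J - K - e' / 2 - p))) with hA
  set Y := exp (u * (P * (J + K + e') / 2)) with hY
  set D := exp (u * (P * ((J - K) / 2 - e' / 2 - p))) with hD
  have hL' : exp (u * ((e + 2 * n - P) * (J - K) / 2 -
      (P - e / 2 - n) * (e' / 2 + (-p - e' : ℤ)))) = A * D⁻¹ := by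
    rw [hA, hD, ← Complex.exp_neg, ← Complex.exp_add]
    congr 1
    push_cast
    ring
  have hR' : exp (u * ((e + 2 * n + P) * (J - K) / 2 +
      (P + e / 2 + n) * (e' / 2 + (-p - e' : ℤ)))) = A * D := by
    rw [hA, hD, ← Complex.exp_add]
    congr 1
    push_cast
    ring
  have h1 : exp (u * P * (p + e' + K : ℤ)) = Y * D⁻¹ := by
    rw [hY, hD, ← Complex.exp_neg, ← Complex.exp_add]
    congr 1
    push_cast
    ring
  have h2 : exp (u * P * (J - p : ℤ)) = Y * D := by
    rw [hY, hD, ← Complex.exp_add]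
    congr 1
    push_cast
    ring
  rw [hL'] at hL
  rw [hR'] at hR
  have hsplit : ∀ L : ℕ, SMatrix M m ((e' : ℝ) / 2) ((e : ℝ) / 2)
      ((e' : ℝ) / 2 + J, (e' : ℝ) / 2 + K)
        ((e : ℝ) / 2 + (P - L - e : ℤ), (e : ℝ) / 2 + (L : ℤ)) *
      ((-1) ^ (P - L - e : ℤ) * latticeCoef M m e' e (P - L - e) L n (-p - e')) =
      1 / M * (-1) ^ (e + 1) * (Y + (-1) ^ (e + e') * Y⁻¹) *
      (exp (u * ((P - e - 2 * (L : ℤ)) * (J - K) / 2)) *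
      ((-1) ^ (P - L - e) * (if (M : ℤ) ∣ n - (P - L - e) then
        charWeight M m ((e' : ℝ) / 2) ((e : ℝ) / 2 + (L : ℤ)) ((n - (P - L - e)) / M)
          (-p - e') else 0)) +
      exp (u * ((P - e - 2 * (L : ℤ)) * (J - K) / 2)) *
      ((-1) ^ (P - L - e) * (if (M : ℤ) ∣ n + e + L then
        charWeight M m ((e' : ℝ) / 2) ((e : ℝ) / 2 + (P - L - e : ℤ)) (-((n + e + L) / M))
          (-(-p - e') - e') else 0))) := by
    intro L
    rw [SMatrix_eq M m he he' hne, ← hu, Complex.exp_neg, ← hY, latticeCoef]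
    ring
  simp only [hsplit]
  rw [← Finset.mul_sum, Finset.sum_add_distrib, hL, hR, Complex.exp_neg, Complex.exp_neg, h1, h2,
    mul_inv, mul_inv, inv_inv, show n + (-p - e') + e + e' = (n - p - e') + (e + e') by ring,
    zpow_add₀ (by norm_num) _ (e + e'), show n + (-p - e') = n - p - e' by ring]
  linear_combination (1 / M * (-1) ^ (e + 1) * (-1) ^ (n - p - e') * A * Y⁻¹ * D) *
    neg_one_zpow_sq (e + e')

/-- The coefficients of the lattice sums transform with `SMatrix`. -/
theorem latticeCoef_S {M m h : ℕ} (hM : M = 2 * h + 1) (hcop : Nat.Coprime M (2 * m + 1))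
    {e e' : ℤ} (he : e = 0 ∨ e = 1) (he' : e' = 0 ∨ e' = 1) (hne : e + e' ≠ 0) {J K : ℤ}
    (hJK : Even (J - K)) (p n : ℤ) :
    ∑ i ∈ Finset.range h, ∑ L ∈ Finset.range M,
      SMatrix M m ((e' : ℝ) / 2) ((e : ℝ) / 2) ((e' : ℝ) / 2 + J, (e' : ℝ) / 2 + K)
        ((e : ℝ) / 2 + (2 * i + 2 - e - L - e : ℤ), (e : ℝ) / 2 + (L : ℤ)) *
      ((-1) ^ (2 * i + 2 - e - L - e : ℤ) *
        latticeCoef M m e' e (2 * i + 2 - e - L - e) L n (-p - e')) =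
      -((-1) ^ J * latticeCoef M m e e' J K p n) := by
  have hM' : (M : ℂ) ≠ 0 := Nat.cast_ne_zero.mpr (by omega)
  rw [Finset.sum_congr rfl fun (i : ℕ) _ => sum_SMatrix_mul_latticeCoef m hM he he' hne hJK p n
    (2 * i + 2 - e) ⟨i + 1 - e, by ring⟩, ← Finset.mul_sum, Finset.sum_add_distrib,
    ← Finset.mul_sum, sum_exp_parity hM hcop he, sum_exp_parity hM hcop he]
  have h0 : (-1 : ℂ) ≠ 0 := by norm_num
  have hsign : (-1 : ℂ) ^ (e * (p + e' + K)) = -((-1) ^ (e + e') * (-1) ^ (e * (J - p))) := by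
    obtain ⟨ν, hν⟩ := hJK
    rw [← zpow_add₀ h0, ← neg_one_mul (_ ^ (_ + _)), ← zpow_one_add₀ h0]
    rcases he with rfl | rfl
    · obtain rfl : e' = 1 := by omega
      norm_num
    · exact neg_one_zpow_congr (c := p - ν - 1) (by linear_combination -hν)
  set A := exp (π * I * (2 * m + 1) / M * ((e / 2 + n) * (J - K - e' / 2 - p))) with hA
  have hcomm : (M : ℤ) ∣ J - p ↔ (M : ℤ) ∣ p - J := dvd_sub_comm
  have hleft : (-1) ^ J * (if (M : ℤ) ∣ p - J then
      charWeight M m ((e : ℝ) / 2) ((e' : ℝ) / 2 + K) ((p - J) / M) n else 0) =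
      (-1) ^ (e + (n - p - e') + (e + e') + e * (J - p)) * A *
        (if (M : ℤ) ∣ J - p then 1 else 0) := by
    simp only [hcomm]
    split_ifs with hd
    · rw [mul_one, neg_one_zpow_mul_charWeight_left m hM e e' J K p n hd]
    · simp
  have hright : (-1) ^ J * (if (M : ℤ) ∣ p + e' + K then
      charWeight M m ((e : ℝ) / 2) ((e' : ℝ) / 2 + J) (-((p + e' + K) / M)) (-n - e) else 0) =
      (-1) ^ (e + (n - p - e') + e * (p + e' + K)) * A *
        (if (M : ℤ) ∣ p + e' + K then 1 else 0) := by
    split_ifs with hd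
    · rw [mul_one, neg_one_zpow_mul_charWeight_right m hM e e' J K p n hJK hd]
    · simp
  rw [latticeCoef, mul_add ((-1 : ℂ) ^ J), hleft, hright]
  simp only [zpow_add₀ h0, zpow_one] at hsign ⊢
  generalize (-1 : ℂ) ^ (e * (p + e' + K)) = s₁, (-1 : ℂ) ^ (e * (J - p)) = s₂ at hsign ⊢
  generalize (if (M : ℤ) ∣ p + e' + K then (1 : ℂ) else 0) = d₁,
    (if (M : ℤ) ∣ J - p then (1 : ℂ) else 0) = d₂
  generalize (-1 : ℂ) ^ (n - p - e') = s, (-1 : ℂ) ^ e = σ, (-1 : ℂ) ^ e' = σ' at hsign ⊢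
  field_simp
  linear_combination (σ * s * A) * hsign

/-! ### The inversion `τ ↦ -1/τ` -/

theorem PsiMod_S {M m h : ℕ} (hM : M = 2 * h + 1) (hcop : Nat.Coprime M (2 * m + 1))
    {e e' : ℤ} (he : e = 0 ∨ e = 1) (he' : e' = 0 ∨ e' = 1) (hne : e + e' ≠ 0) {J K : ℤ}
    (hJK : Even (J - K)) {τ z : ℂ} (hτ : 0 < τ.im)
    (hreg : IsRegular ((e' : ℝ) / 2) ((e : ℝ) / 2) τ z) :
    (-1) ^ J * PsiMod M m ((e : ℝ) / 2) ((e' : ℝ) / 2 + J) ((e' : ℝ) / 2 + K)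
        (-1 / τ) (z / τ) (-(z / τ)) 0 =
      -(τ * exp (-(π * I * (2 * m + 1) * z ^ 2 / (M * τ)))) *
        ∑ x ∈ Omega M ((e : ℝ) / 2),
          SMatrix M m ((e' : ℝ) / 2) ((e : ℝ) / 2) ((e' : ℝ) / 2 + J, (e' : ℝ) / 2 + K) x *
            (exp (π * I * (x.1 - ((e : ℝ) / 2 : ℝ))) *
              PsiMod M m ((e' : ℝ) / 2) x.1 x.2 τ z (-z) 0) := by
  have hM0 : M ≠ 0 := by omega
  have hτ0 : τ ≠ 0 := by
    rintro rfl
    simp at hτ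
  have hτ' : 0 < (-1 / τ).im := by
    rw [neg_div, one_div, Complex.neg_im, Complex.inv_im, neg_div, neg_neg]
    exact div_pos hτ (Complex.normSq_pos.mpr hτ0)
  have hl := hasSum_latticeCoef M m hM0 (τ := -1 / τ) (z := z / τ) hτ' e e' J K (by
    intro p r h0
    refine (hreg p (-r - e)).2 ?_
    field_simp at h0
    push_cast at h0 ⊢
    linear_combination h0)
  simp only [charTerm_S M m hτ] at hl
  set X := τ * exp (-(π * I * (2 * m + 1) * z ^ 2 / (M * τ))) with hX
  have hr : ∀ J' K' : ℤ, HasSum (fun x : ℤ × ℤ => latticeCoef M m e' e J' K' x.2 (-x.1 - e') *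
      charTerm M m τ z ((e : ℝ) / 2 + x.2) (-((e' : ℝ) / 2 + x.1)))
      (-2 * π * I * PsiMod M m ((e' : ℝ) / 2) ((e : ℝ) / 2 + J') ((e : ℝ) / 2 + K') τ z (-z) 0) := by
    intro J' K'
    have h := hasSum_latticeCoef M m hM0 (z := z) hτ e' e J' K' (by
      intro p r h0
      refine (hreg (-r - e') (-p - e)).2 ?_
      push_cast at h0 ⊢
      linear_combination h0)
    refine (((Equiv.prodComm ℤ ℤ).trans
      ((Equiv.refl ℤ).prodCongr (Equiv.subLeft (-e')))).hasSum_iff.mpr h).congr_fun fun x => ?_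
    simp only [Function.comp_apply, Equiv.trans_apply, Equiv.prodComm_apply, Equiv.prodCongr_apply,
      Prod.map, Prod.fst_swap, Prod.snd_swap, Equiv.refl_apply, Equiv.subLeft_apply,
      show -e' - x.1 = -x.1 - e' by ring]
    congr 2
    push_cast
    ring
  have hsum := hasSum_sum (s := Finset.range h) fun (i : ℕ) _ =>
    hasSum_sum (s := Finset.range M) fun (L : ℕ) _ =>
      (hr (2 * i + 2 - e - L - e) L).mul_left
        (SMatrix M m ((e' : ℝ) / 2) ((e : ℝ) / 2) ((e' : ℝ) / 2 + J, (e' : ℝ) / 2 + K)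
        ((e : ℝ) / 2 + (2 * i + 2 - e - L - e : ℤ), (e : ℝ) / 2 + (L : ℤ)) *
        (-1) ^ (2 * i + 2 - e - L - e : ℤ))
  have huniq := (hl.mul_left ((-1) ^ J)).unique
    ((hsum.mul_left (-X)).congr_fun fun x => by
      trans -X * (-((-1) ^ J * latticeCoef M m e e' J K x.1 x.2) *
        charTerm M m τ z ((e : ℝ) / 2 + x.2) (-((e' : ℝ) / 2 + x.1)))
      · ring
      · rw [← latticeCoef_S (m := m) hM hcop he he' hne hJK, Finset.sum_mul]
        simp only [Finset.sum_mul, mul_assoc])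
  rw [sum_Omega hM he]
  have hpi : (-2 * π * I : ℂ) ≠ 0 := by
    simp [Real.pi_ne_zero]
  apply mul_left_cancel₀ hpi
  rw [mul_left_comm, huniq, mul_left_comm (-2 * π * I : ℂ)]
  congr 1
  rw [Finset.mul_sum]
  refine Finset.sum_congr rfl fun i _ => ?_
  rw [Finset.mul_sum]
  refine Finset.sum_congr rfl fun L _ => ?_
  rw [neg_one_zpow_eq_exp]
  push_cast
  ring_nf

theorem chMod_S {M m : ℕ} (hM : Odd M) (hcop : Nat.Coprime M (2 * m + 1)) {ε ε' : ℝ}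
    (hε : ε = 0 ∨ ε = 1 / 2) (hε' : ε' = 0 ∨ ε' = 1 / 2) (hne : ε + ε' ≠ 0) {j k : ℝ}
    (hjk : (j, k) ∈ Omega M ε') {τ z : ℂ} (hτ : 0 < τ.im) (hreg : IsRegular ε' ε τ z) :
    chMod M m ε ε' j k (-1 / τ) (z / τ) =
      exp (π * I * centralCharge M m * z ^ 2 / (3 * τ)) *
        ∑ x ∈ Omega M ε, SMatrix M m ε' ε (j, k) x * chMod M m ε' ε x.1 x.2 τ z := by
  obtain ⟨h, hM⟩ := hM
  obtain ⟨J, K, hj, hk, hJK⟩ := exists_int_of_mem_Omega hjk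
  simp only at hj hk
  have hM' : (M : ℂ) ≠ 0 := Nat.cast_ne_zero.mpr (by omega)
  have hτ0 : τ ≠ 0 := by
    rintro rfl
    simp at hτ
  have hhalf : ∀ {δ : ℝ}, δ = 0 ∨ δ = 1 / 2 → ∃ e : ℤ, (e = 0 ∨ e = 1) ∧ δ = (e : ℝ) / 2 := by
    rintro δ (rfl | rfl)
    · exact ⟨0, Or.inl rfl, by simp⟩
    · exact ⟨1, Or.inr rfl, by simp⟩
  have hR := R3_S hε hε' hne hτ z
  obtain ⟨e, he, rfl⟩ := hhalf hε
  obtain ⟨e', he', rfl⟩ := hhalf hε'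
  have hne' : e + e' ≠ 0 := by
    intro h0
    apply hne
    rw [← add_div, ← Int.cast_add, h0]
    simp
  have hS := PsiMod_S hM hcop he he' hne' hJK hτ hreg
  have hsgn : exp (π * I * (((e' : ℝ) / 2 + J : ℝ) - ((e' : ℝ) / 2 : ℝ))) = (-1 : ℂ) ^ J := by
    rw [neg_one_zpow_eq_exp]
    push_cast
    ring_nf
  have hc : exp (π * I * centralCharge M m * z ^ 2 / (3 * τ)) =
      exp (-(π * I * (2 * m + 1) * z ^ 2 / (M * τ))) := by
    congr 1
    rw [centralCharge]
    push_cast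
    field_simp
  simp only [chMod]
  rw [hj, hk, hsgn, hS, hR, hc]
  simp only [mul_div_assoc', ← Finset.sum_div]
  rw [neg_mul, neg_mul, neg_div_neg_eq, mul_assoc τ, mul_div_mul_left _ _ hτ0]

end SuperconformalN3

end

theorem theorem6p3 (m M : ℕ) (hM : 2 ≤ M) (hcop : Nat.gcd M (4 * m + 2) = 1)
    (ε ε' : ℝ) (hε : ε = 0 ∨ ε = 1 / 2) (hε' : ε' = 0 ∨ ε' = 1 / 2) (hne : ε + ε' ≠ 0)
    (j k : ℝ) (hjk : (j, k) ∈ SuperconformalN3.Omega M ε') :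
    (∀ τ z : ℂ, 0 < τ.im → SuperconformalN3.IsRegular ε' ε τ z →
      SuperconformalN3.chMod M m ε ε' j k (-1 / τ) (z / τ) =
        Complex.exp (Real.pi * Complex.I * SuperconformalN3.centralCharge M m * z ^ 2 / (3 * τ)) *
          ∑ x ∈ SuperconformalN3.Omega M ε,
            SuperconformalN3.SMatrix M m ε' ε (j, k) x *
              SuperconformalN3.chMod M m ε' ε x.1 x.2 τ z) ∧
    (∀ τ z : ℂ, 0 < τ.im → SuperconformalN3.IsRegular ε ε' (τ + 1) z →
      SuperconformalN3.chMod M m ε ε' j k (τ + 1) z =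
        Complex.exp (-(Real.pi * Complex.I * (j + 1 / 12 - ε' / 4 + 4 * ε * ε'))) *
          Complex.exp (2 * Real.pi * Complex.I * (2 * m + 1) / (2 * M) * (j * k)) *
          SuperconformalN3.chMod M m |ε - ε'| ε' j k τ z) := by
  have hcop' : Nat.Coprime M (2 * (2 * m + 1)) := by
    rw [show 2 * (2 * m + 1) = 4 * m + 2 by ring]
    exact hcop
  have hodd : Odd M := Nat.coprime_two_right.mp hcop'.coprime_mul_right_right
  exact ⟨fun τ z hτ hreg =>
      SuperconformalN3.chMod_S hodd hcop'.coprime_mul_left_right hε hε' hne hjk hτ hreg,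
    fun τ z hτ hreg => SuperconformalN3.chMod_T M m hodd hε hε' hne hjk hτ hreg⟩
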